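/- **Setting.** Fix $N\ge 1$, put $\mathbb S=\{1,\dots,N\}$, $\bar{\mathbb S}=\{\bar 1,\dots,\bar N\}$, $\mathcal S=\mathbb S\cup\bar{\mathbb S}$, and let $\operatorname{sg}(k)=1$, $\operatorname{sg}(\bar k)=-1$; $\nu_k=1$ for $k\in\mathbb S\setminus\{1\}$ and $\nu_a=0$ for all other $a\in\mathcal S$. Charges are $s=(s_a)_{a\in\mathcal S}\in\mathbb Z^{\mathcal S}$ with $\sum_a s_a=0$. Times $t_{ja}\in\mathbb C$ ($j\ge1$, $a\in\mathcal S$) are fixed, only finitely many of them nonzero; $D_a$ is the largest $j$ with $t_{ja}\neq0$ (or $0$). Operators are formal series $\sum_j X_j(n)\Lambda^j$, $X_j:\mathbb Z\to M_N(\mathbb C)$, $(\Lambda f)(n)=f(n+1)$, with projections $(\cdot)_+$ onto $j\ge0$ and $(\cdot)_-$ onto $j<0$. Put $$W_0=\sum_k E_{kk}\Lambda^{s_k}e^{\sum_{j\ge1}t_{jk}\Lambda^j},\qquad \bar W_0=\sum_kE_{kk}\Lambda^{-s_{\bar k}}e^{\sum_{j\ge1}t_{j\bar k}\Lambda^{-j}}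 .$$ Let $U\subseteq\mathbb C$ be open, and for $\beta\in U$ and every $s$ let $S=1+\sum_{i\ge1}\varphi_i(n)\Lambda^{-i}$ and $\bar S=\sum_{i\ge0}\bar\varphi_i(n)\Lambda^i$ ($\bar\varphi_0(n)$ invertible) be such that $W=SW_0$, $\bar W=\bar S\bar W_0$ solve a factorization problem $W g=\bar W$ with $g$ independent of $s$; for formal series this means $W(s)W(s')^{-1}=\bar W(s)\bar W(s')^{-1}$ for all charges $s,s'$. Let $L=W\Lambda W^{-1}$, $M=WnW^{-1}$, $C_{kk}=WE_{kk}W^{-1}$, $\bar L=\bar W\Lambda\bar W^{-1}$, $\bar M=\bar Wn\bar W^{-1}$, $\bar C_{kk}=\bar WE_{kk}\bar W^{-1}$. For $a,b\in\mathcal S$ let $T_{(a,b)}$ be the shift $s_a\mapsto s_a+1$, $s_b\mapsto s_b-1$. Fix $a_0\in\mathcal S\setminus\{1\}$, $\bar a_0\in\mathcal S\setminus\{\bar1\}$ and put $T_1=T_{(1,a_0)}$, $T_a=T_{(a,1)}$ for $a\ne1$, and $\bar T_{\bar1}=T_{(\bar1,\bar a_0)}$, $\bar T_a=T_{(a,\bar1)}$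 for $a\neq\bar1$. Define the scalar operators $$\mathcal K_1=1+\sum_{i\ge1}\varphi_{i,11}T_1^{-i},\quad \mathcal K_k=\sum_{i\ge0}\varphi_{i+1,1k}T_k^{-i}\ (k\neq1),\quad \mathcal K_{\bar k}=\sum_{i\ge0}\bar\varphi_{i,1k}T_{\bar k}^{-i},$$ $\mathcal W_a=\mathcal K_a\exp(\sum_{j\ge1}t_{ja}T_a^j)$, $\mathcal L_a=\mathcal W_aT_a\mathcal W_a^{-1}$, $\mathcal M_a=n-\nu_a+\operatorname{sg}(a)\mathcal W_as_a\mathcal W_a^{-1}$, and $\bar{\mathcal K}_a,\bar{\mathcal L}_a,\bar{\mathcal M}_a$ by the same formulas with $\bar T_a$ in place of $T_a$. All $\mathcal K_a$ and $\bar{\mathcal K}_a$ are assumed to be invertible (as formal series bounded above in the shift). The projection $X_+$ of $X=\sum_jc_jT_a^j$ is $\sum_{j\ge0}c_jT_a^j$ for $a=1$ and $\sum_{j>0}c_jT_a^j$ for $a\ne1$. The projection $X_+$ of $X=\sum_jc_j\bar T_a^j$ is $\sum_{j\ge0}c_j\bar T_a^j$ for $a=1$; it is $\sum_{j>0}c_j\bar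 T_a^j$ for $a=\bar1$ if $\bar a_0=1$; in all other cases it is $\sum_{j>0}c_j(\bar T_a^j-1)$. The vector wave functions are $\Psi_k=\psi_{1k}$, $\Psi_{\bar k}=\bar\psi_{1k}$, where $\psi=W\chi$, $\bar\psi=\bar W\chi$, $\chi(n)=z^n\mathbb I_N$; thus $\Psi_a$ is a formal Laurent series in $z$ times the formal symbol $\exp(\sum_{j\ge1}t_{ja}z^{\operatorname{sg}(a)j})$. For $a\in\mathcal S$ let $F_a(x,y)=\sum_{i\ge0,\,j\in\mathbb Z}F_{aij}x^iy^j$ with $F_{aij}\in\mathbb C$ (and the ordering $x^iy^j$ also for non-commuting arguments), such that for each $m\in\mathbb Z$ only finitely many $(i,j)$ satisfy $F_{aij}\neq0$ and $D_ai+j\ge m$; so all the series below are well-defined formal series. **Proposition.** Let $\mathfrak b\in U$ and suppose that at $\beta=\mathfrak b$, for all charges, coefficientwise, $$\partial_{\mathfrak b}E_{11}W=-E_{11}\Big(\sum_{k=1}^N\big(F_k(M,L)C_{kk}-F_{\bar k}(\bar M,\bar L^{-1})\bar C_{kk}\big)\Big)_-W,$$ $$\partial_{\mathfrak b}E_{11}\bar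 W=E_{11}\Big(\sum_{k=1}^N\big(F_k(M,L)C_{kk}-F_{\bar k}(\bar M,\bar L^{-1})\bar C_{kk}\big)\Big)_+\bar W .$$ Then at $\beta=\mathfrak b$, for every $a\in\mathcal S$, $$\partial_{\mathfrak b}\Psi_a=-F_a(\mathcal M_a,\mathcal L_a)\Psi_a+\Big(\sum_{a'\in\mathcal S}F_{a'}(\mathcal M_{a'},\mathcal L_{a'})_+\Big)\Psi_a =-F_a(\bar{\mathcal M}_a,\bar{\mathcal L}_a)\Psi_a+\Big(\sum_{a'\in\mathcal S}F_{a'}(\bar{\mathcal M}_{a'},\bar{\mathcal L}_{a'})_+\Big)\Psi_a .$$ -/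

import Mathlib

open scoped BigOperators

namespace Toda

noncomputable section

/-! ### Formal Laurent series in a shift operator -/

/-- Formal series `∑_{j ≤ d} a_j T^j` (`d` depends on the series), with coefficients in an algebra
`A` of functions and a symbol `T` subject to `T a = σ(a) T`. -/
@[ext]
structure ShiftSeries {A : Type*} [Ring A] [Algebra ℂ A] (σ : A ≃ₐ[ℂ] A) where
  /-- `coeff j` is the coefficient that stands to the left of `T^j` -/
  coeff : ℤ → A
  bdd : ∃ d : ℤ, ∀ j, d < j → coeff j = 0

namespace ShiftSeries

variable {A : Type*} [Ring A] [Algebra ℂ A] {σ : A ≃ₐ[ℂ] A}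

theorem bddBelow_support (x : ShiftSeries σ) :
    BddBelow (Function.support fun i : ℤᵒᵈ =>
      (LinearMap.mulLeft ℂ (x.coeff (OrderDual.ofDual i)) ∘ₗ
        (σ ^ (OrderDual.ofDual i)).toLinearMap : Module.End ℂ A)) := by
  obtain ⟨d, hd⟩ := x.bdd
  refine ⟨OrderDual.toDual d, fun i hi => ?_⟩
  by_contra h
  apply hi
  have : d < OrderDual.ofDual i := by
    by_contra h'
    exact h (not_lt.mp h')
  simp [hd _ this]

/-- A shift series as a formal series of operators `a_j T^j` acting on `A`. It serves to
transport the ring axioms. -/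
def toHahn (x : ShiftSeries σ) : HahnSeries ℤᵒᵈ (Module.End ℂ A) :=
  HahnSeries.ofSuppBddBelow _ x.bddBelow_support

theorem toHahn_coeff (x : ShiftSeries σ) (j : ℤ) (f : A) :
    (toHahn x).coeff (OrderDual.toDual j) f = x.coeff j * (σ ^ j) f := rfl

theorem toHahn_injective : Function.Injective (toHahn (σ := σ)) := by
  intro x y h
  ext1
  funext j
  have := congrArg (fun z : HahnSeries ℤᵒᵈ (Module.End ℂ A) => z.coeff (OrderDual.toDual j) 1) h
  simpa [toHahn_coeff] using this

instance : Zero (ShiftSeries σ) := ⟨⟨fun _ => 0, 0, fun _ _ => rfl⟩⟩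

instance : Add (ShiftSeries σ) :=
  ⟨fun x y => ⟨fun j => x.coeff j + y.coeff j, by
    obtain ⟨d, hd⟩ := x.bdd
    obtain ⟨e, he⟩ := y.bdd
    exact ⟨max d e, fun j hj => by
      simp [hd j (lt_of_le_of_lt (le_max_left _ _) hj),
        he j (lt_of_le_of_lt (le_max_right _ _) hj)]⟩⟩⟩

instance : Neg (ShiftSeries σ) :=
  ⟨fun x => ⟨fun j => -x.coeff j, by
    obtain ⟨d, hd⟩ := x.bdd
    exact ⟨d, fun j hj => by simp [hd j hj]⟩⟩⟩

instance : SMul ℂ (ShiftSeries σ) :=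
  ⟨fun c x => ⟨fun j => c • x.coeff j, by
    obtain ⟨d, hd⟩ := x.bdd
    exact ⟨d, fun j hj => by simp [hd j hj]⟩⟩⟩

/-- The monomial `a T^j`. -/
def monomial (a : A) (j : ℤ) : ShiftSeries σ :=
  ⟨fun i => if i = j then a else 0, j, fun _ hi => if_neg hi.ne'⟩

instance : One (ShiftSeries σ) := ⟨monomial 1 0⟩

/-- The product, `(a T^i)(b T^j) = a σ^i(b) T^{i+j}`; for each coefficient the sum is finite. -/
instance : Mul (ShiftSeries σ) :=
  ⟨fun x y => ⟨fun m => ∑ᶠ i : ℤ, x.coeff i * (σ ^ i) (y.coeff (m - i)), by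
    obtain ⟨d, hd⟩ := x.bdd
    obtain ⟨e, he⟩ := y.bdd
    refine ⟨d + e, fun m hm => finsum_eq_zero_of_forall_eq_zero fun i => ?_⟩
    by_cases hi : d < i
    · simp [hd i hi]
    · simp [he (m - i) (by omega)]⟩⟩

theorem coeff_zero (j : ℤ) : (0 : ShiftSeries σ).coeff j = 0 := rfl

theorem coeff_add (x y : ShiftSeries σ) (j : ℤ) :
    (x + y).coeff j = x.coeff j + y.coeff j := rfl

theorem coeff_neg (x : ShiftSeries σ) (j : ℤ) : (-x).coeff j = -x.coeff j := rfl

theorem coeff_smul (c : ℂ) (x : ShiftSeries σ) (j : ℤ) : (c • x).coeff j = c • x.coeff j := rfl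

theorem coeff_monomial (a : A) (j i : ℤ) :
    (monomial a j : ShiftSeries σ).coeff i = if i = j then a else 0 := rfl

theorem coeff_one (i : ℤ) : (1 : ShiftSeries σ).coeff i = if i = 0 then 1 else 0 := rfl

theorem coeff_mul (x y : ShiftSeries σ) (m : ℤ) :
    (x * y).coeff m = ∑ᶠ i : ℤ, x.coeff i * (σ ^ i) (y.coeff (m - i)) := rfl

theorem toHahn_zero : toHahn (0 : ShiftSeries σ) = 0 := by
  ext i f
  exact zero_mul _

theorem toHahn_add (x y : ShiftSeries σ) : toHahn (x + y) = toHahn x + toHahn y := by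
  ext i f
  exact add_mul _ _ _

theorem toHahn_smul (c : ℂ) (x : ShiftSeries σ) : toHahn (c • x) = c • toHahn x := by
  ext i f
  exact smul_mul_assoc _ _ _

theorem toHahn_one : toHahn (1 : ShiftSeries σ) = 1 := by
  ext i f
  induction i using OrderDual.rec with
  | toDual i =>
    rw [toHahn_coeff, coeff_one, HahnSeries.coeff_one]
    by_cases h : i = 0
    · subst h
      simp
    · have h' : ¬ OrderDual.toDual i = 0 := h
      simp [h, h']

theorem toHahn_mul (x y : ShiftSeries σ) : toHahn (x * y) = toHahn x * toHahn y := by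
  ext i f
  induction i using OrderDual.rec with
  | toDual m =>
    obtain ⟨d, hd⟩ := x.bdd
    obtain ⟨e, he⟩ := y.bdd
    rw [toHahn_coeff, coeff_mul, HahnSeries.coeff_mul, LinearMap.sum_apply]
    have key : ∀ i : ℤ, (toHahn x).coeff (OrderDual.toDual i)
        ((toHahn y).coeff (OrderDual.toDual (m - i)) f) =
        x.coeff i * (σ ^ i) (y.coeff (m - i)) * (σ ^ m) f := by
      intro i
      rw [toHahn_coeff, toHahn_coeff, map_mul, ← mul_assoc, ← AlgEquiv.mul_apply, ← zpow_add]
      simp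
    have hsupp : (Function.support fun i : ℤ => x.coeff i * (σ ^ i) (y.coeff (m - i))) ⊆
        (Finset.Icc (m - e) d : Finset ℤ) := by
      intro i hi
      rw [Finset.coe_Icc, Set.mem_Icc]
      by_contra h
      apply hi
      by_cases hi' : d < i
      · simp [hd i hi']
      · simp [he (m - i) (by omega)]
    rw [finsum_eq_sum_of_support_subset _ hsupp, Finset.sum_mul]
    symm
    refine Finset.sum_of_injOn (fun p => OrderDual.ofDual p.1) ?_ ?_ ?_ ?_
    · rintro ⟨a, b⟩ h ⟨a', b'⟩ h' hab
      simp only [Finset.mem_coe, Finset.mem_antidiagonal] at h h'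
      have h1 : a = a' := hab
      subst h1
      have := h.2.2.trans h'.2.2.symm
      simpa using this
    · rintro ⟨a, b⟩ h
      simp only [Finset.mem_coe, Finset.mem_antidiagonal, HahnSeries.mem_support] at h
      obtain ⟨h1, h2, h3⟩ := h
      have hb : OrderDual.ofDual b = m - OrderDual.ofDual a := by
        have : OrderDual.ofDual a + OrderDual.ofDual b = m := h3
        omega
      simp only [Finset.coe_Icc, Set.mem_Icc]
      constructor
      · by_contra hlt
        apply h2
        ext g
        have := toHahn_coeff y (OrderDual.ofDual b) g
        rw [he _ (by omega), zero_mul] at this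
        exact this
      · by_contra hlt
        apply h1
        ext g
        have := toHahn_coeff x (OrderDual.ofDual a) g
        rw [hd _ (by omega), zero_mul] at this
        exact this
    · intro i _ hi
      rw [← key]
      by_contra hne
      apply hi
      refine ⟨(OrderDual.toDual i, OrderDual.toDual (m - i)), ?_, rfl⟩
      simp only [Finset.mem_coe, Finset.mem_antidiagonal, HahnSeries.mem_support]
      refine ⟨fun h0 => hne ?_, fun h0 => hne ?_, ?_⟩
      · rw [h0]; rfl
      · rw [h0]; simp
      · rw [← toDual_add]; simp
    · rintro ⟨a, b⟩ h
      simp only [Finset.mem_antidiagonal] at h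
      have hb : b = OrderDual.toDual (m - OrderDual.ofDual a) := by
        have h3 : OrderDual.ofDual a + OrderDual.ofDual b = m := h.2.2
        have : OrderDual.ofDual b = m - OrderDual.ofDual a := by omega
        rw [← this]; rfl
      subst hb
      exact key (OrderDual.ofDual a)

instance : Ring (ShiftSeries σ) :=
  Ring.ofMinimalAxioms
    (fun _ _ _ => ShiftSeries.ext (funext fun _ => add_assoc _ _ _))
    (fun _ => ShiftSeries.ext (funext fun _ => zero_add _))
    (fun _ => ShiftSeries.ext (funext fun _ => neg_add_cancel _))
    (fun x y z => toHahn_injective (by simp only [toHahn_mul, mul_assoc]))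
    (fun x => toHahn_injective (by simp only [toHahn_mul, toHahn_one, one_mul]))
    (fun x => toHahn_injective (by simp only [toHahn_mul, toHahn_one, mul_one]))
    (fun x y z => toHahn_injective (by simp only [toHahn_mul, toHahn_add, mul_add]))
    (fun x y z => toHahn_injective (by simp only [toHahn_mul, toHahn_add, add_mul]))

instance : Module ℂ (ShiftSeries σ) where
  one_smul _ := ShiftSeries.ext (funext fun _ => one_smul _ _)
  mul_smul _ _ _ := ShiftSeries.ext (funext fun _ => mul_smul _ _ _)
  smul_zero _ := ShiftSeries.ext (funext fun _ => smul_zero _)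
  smul_add _ _ _ := ShiftSeries.ext (funext fun _ => smul_add _ _ _)
  add_smul _ _ _ := ShiftSeries.ext (funext fun _ => add_smul _ _ _)
  zero_smul _ := ShiftSeries.ext (funext fun _ => zero_smul _ _)

instance : Algebra ℂ (ShiftSeries σ) :=
  Algebra.ofModule
    (fun c x y => toHahn_injective (by
      rw [toHahn_mul, toHahn_smul, toHahn_smul, toHahn_mul]
      exact Algebra.smul_mul_assoc _ _ _))
    (fun c x y => toHahn_injective (by
      rw [toHahn_mul, toHahn_smul, toHahn_smul, toHahn_mul]
      exact Algebra.mul_smul_comm _ _ _))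

open Classical in
/-- The series with the given coefficients, provided that it is bounded above. -/
def ofCoeff (c : ℤ → A) : ShiftSeries σ :=
  if h : ∃ d : ℤ, ∀ j, d < j → c j = 0 then ⟨c, h⟩ else 0

open Classical in
/-- The part `∑_{j ∈ J} a_j T^j` of `∑ a_j T^j`. -/
def part (J : Set ℤ) (x : ShiftSeries σ) : ShiftSeries σ :=
  ⟨fun j => if j ∈ J then x.coeff j else 0, by
    obtain ⟨d, hd⟩ := x.bdd
    exact ⟨d, fun j hj => by simp [hd j hj]⟩⟩

/-- `e^τ x e^{-τ} = ∑_m (ad τ)^m(x) / m!`. It is only used where the sum is finite. -/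
def expConj (τ x : ShiftSeries σ) : ShiftSeries σ :=
  ∑ᶠ m : ℕ, ((m.factorial : ℂ)⁻¹) • ((fun y => τ * y - y * τ)^[m] x)

/-- `∑_{i ≥ 0, j ∈ ℤ} f_{ij} M^i L^j C`, summed coefficient by coefficient;
`L j` stands for the `j`-th power `L^j`. -/
def evalSymbol (f : ℕ → ℤ → ℂ) (M : ShiftSeries σ) (L : ℤ → ShiftSeries σ)
    (C : ShiftSeries σ) : ShiftSeries σ :=
  ofCoeff fun m => ∑ᶠ p : ℕ × ℤ, f p.1 p.2 • (M ^ p.1 * L p.2 * C).coeff m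

end ShiftSeries

open ShiftSeries

/-- Translation `(T f)(x) = f(x + v)` on functions with values in an algebra. -/
def transl {X R : Type*} [AddCommGroup X] [Ring R] [Algebra ℂ R] (v : X) :
    (X → R) ≃ₐ[ℂ] (X → R) where
  toFun f x := f (x + v)
  invFun f x := f (x - v)
  left_inv f := by funext x; simp
  right_inv f := by funext x; simp
  map_mul' _ _ := rfl
  map_add' _ _ := rfl
  commutes' _ := rfl

/-! ### Indices, charges, times -/

/-- The index set `𝒮`: `Sum.inl k` is the index `k`, `Sum.inr k` the index `k̄`. The first
element of `Fin N` is `0`. -/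
abbrev Idx (N : ℕ) := Fin N ⊕ Fin N

/-- `sg a` is `1` on unbarred and `-1` on barred indices. -/
def sg {N : ℕ} : Idx N → ℤ
  | Sum.inl _ => 1
  | Sum.inr _ => -1

/-- `ν_a` is `1` for `a = k ≠ 1` and `0` otherwise. -/
def nu {N : ℕ} [NeZero N] : Idx N → ℤ
  | Sum.inl k => if k = 0 then 0 else 1
  | Sum.inr _ => 0

/-- The zero charge sector: charges `(s_a)` with `∑ s_a = 0`. -/
def Charge (N : ℕ) : AddSubgroup (Idx N → ℤ) where
  carrier := {s | ∑ a, s a = 0}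
  zero_mem' := by simp
  add_mem' := by
    intro s r hs hr
    simp only [Set.mem_ofPred_eq] at hs hr ⊢
    simp only [Pi.add_apply, Finset.sum_add_distrib, hs, hr, add_zero]
  neg_mem' := by
    intro s hs
    simp only [Set.mem_ofPred_eq] at hs ⊢
    simp only [Pi.neg_apply, Finset.sum_neg_distrib, hs, neg_zero]

/-- The step of the charge preserving shift `T_{(a,b)}`: `s_a ↦ s_a + 1`, `s_b ↦ s_b - 1`. -/
def step {N : ℕ} (a b : Idx N) : Charge N :=
  ⟨Pi.single a 1 - Pi.single b 1, by
    change ∑ c, (Pi.single a 1 - Pi.single b 1 : Idx N → ℤ) c = 0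
    simp [Finset.sum_sub_distrib]⟩

/-- The largest `j` with `t_{ja} ≠ 0` (and `0` if there is none). -/
def timeDeg {N : ℕ} (t : Idx N → ℕ →₀ ℂ) (a : Idx N) : ℕ := (t a).support.sup id

/-! ### Matrix operators and the factorization problem -/

/-- Functions of the discrete variable `n` with values in the complex `N × N` matrices. -/
abbrev MatFun (N : ℕ) := ℤ → Matrix (Fin N) (Fin N) ℂ

/-- Formal series `∑_j X_j(n) Λ^{ε j}` that are bounded above in `j`, with `(Λ f)(n) = f(n + 1)`.
For `ε = 1` these are the series that descend in `Λ`, for `ε = -1` those that ascend in `Λ`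
(the coefficient with index `j` then belongs to `Λ^{-j}`). -/
abbrev MatOp (N : ℕ) (ε : ℤ) := ShiftSeries (transl ε : MatFun N ≃ₐ[ℂ] MatFun N)

section Matrix

variable {N : ℕ} (ε : ℤ) (e : Fin N → Idx N)

/-- The constant function `E_kk`. -/
def diagUnit (k : Fin N) : MatFun N := fun _ => Matrix.single k k 1

/-- `∑_k E_kk Λ^{ε s_{e(k)}}`: the factor of `W₀` (`ε = 1`, `e(k) = k`), respectively of `W̄₀`
(`ε = -1`, `e(k) = k̄`), that carries the charges. -/
def chargeOp (s : Idx N → ℤ) : MatOp N ε := ∑ k, monomial (diagUnit k) (s (e k))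

/-- `∑_k E_kk ∑_{j ≥ 1} t_{j e(k)} Λ^{ε j}`: the exponent in `W₀`, respectively in `W̄₀`. -/
def timeOp (t : Idx N → ℕ →₀ ℂ) : MatOp N ε :=
  ∑ k, ∑ j ∈ Finset.Icc 1 (timeDeg t (e k)), t (e k) j • monomial (diagUnit k) (j : ℤ)

/-- `W X W⁻¹`, where `W = P W₀` and `W₀` is the product of `exp (timeOp)` and `chargeOp`. -/
def dress (t : Idx N → ℕ →₀ ℂ) (s : Idx N → ℤ) (P : (MatOp N ε)ˣ) (X : MatOp N ε) : MatOp N ε :=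
  (P : MatOp N ε) * expConj (timeOp ε e t) (chargeOp ε e s * X * chargeOp ε e (-s)) *
    ((P⁻¹ : (MatOp N ε)ˣ) : MatOp N ε)

/-- `M = W n W⁻¹`, respectively `M̄ = W̄ n W̄⁻¹`. -/
def orlov (t : Idx N → ℕ →₀ ℂ) (s : Idx N → ℤ) (P : (MatOp N ε)ˣ) : MatOp N ε :=
  dress ε e t s P (monomial (fun n => (n : ℂ) • 1) 0)

/-- `L^j = W Λ^j W⁻¹`, respectively `L̄^{-j} = W̄ Λ^{-j} W̄⁻¹`. -/
def laxPow (t : Idx N → ℕ →₀ ℂ) (s : Idx N → ℤ) (P : (MatOp N ε)ˣ) (j : ℤ) : MatOp N ε :=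
  dress ε e t s P (monomial 1 j)

/-- `C_kk = W E_kk W⁻¹`, respectively `C̄_kk = W̄ E_kk W̄⁻¹`. -/
def diagProj (t : Idx N → ℕ →₀ ℂ) (s : Idx N → ℤ) (P : (MatOp N ε)ˣ) (k : Fin N) : MatOp N ε :=
  dress ε e t s P (monomial (diagUnit k) 0)

/-- `∑_k F_k(M, L) C_kk`, respectively `∑_k F_{k̄}(M̄, L̄⁻¹) C̄_kk`. -/
def symbolSum (F : Idx N → ℕ → ℤ → ℂ) (t : Idx N → ℕ →₀ ℂ) (s : Idx N → ℤ)
    (P : (MatOp N ε)ˣ) : MatOp N ε :=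
  ∑ k, evalSymbol (F (e k)) (orlov ε e t s P) (laxPow ε e t s P) (diagProj ε e t s P k)

end Matrix

section Factorization

variable {N : ℕ}

/-- `S ∈ G₋` and `S̄ ∈ G₊` solve a factorization problem `S W₀ g = S̄ W̄₀` at every charge, with an
element `g` that does not depend on the charges. As `S W₀` descends and `S̄ W̄₀` ascends in `Λ`,
independence of `g = W⁻¹ W̄` from the charges is expressed by
`W(s) W(s')⁻¹ = W̄(s) W̄(s')⁻¹`, where both sides are well-defined formal series (the exponential
factors, which do not depend on the charges, cancel). -/
structure IsFactorization (S : Charge N → (MatOp N 1)ˣ) (S' : Charge N → (MatOp N (-1))ˣ) :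
    Prop where
  lower_coeff : ∀ s j, 0 < j → (S s : MatOp N 1).coeff j = 0
  lower_leading : ∀ s, (S s : MatOp N 1).coeff 0 = 1
  upper_coeff : ∀ s j, 0 < j → (S' s : MatOp N (-1)).coeff j = 0
  upper_inv_coeff : ∀ s j, 0 < j →
    (((S' s)⁻¹ : (MatOp N (-1))ˣ) : MatOp N (-1)).coeff j = 0
  factor : ∀ (s s' : Charge N) (j : ℤ),
    ((S s : MatOp N 1) * chargeOp 1 Sum.inl s * chargeOp 1 Sum.inl (-s') *
        (((S s')⁻¹ : (MatOp N 1)ˣ) : MatOp N 1)).coeff j =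
      ((S' s : MatOp N (-1)) * chargeOp (-1) Sum.inr s * chargeOp (-1) Sum.inr (-s') *
        (((S' s')⁻¹ : (MatOp N (-1))ˣ) : MatOp N (-1))).coeff (-j)

/-- The coefficient of `Λ^j` in
`H = ∑_k (F_k(M, L) C_kk - F_{k̄}(M̄, L̄⁻¹) C̄_kk)` at the charges `s`. -/
def symmetryCoeff (F : Idx N → ℕ → ℤ → ℂ) (t : Idx N → ℕ →₀ ℂ) (S : Charge N → (MatOp N 1)ˣ)
    (S' : Charge N → (MatOp N (-1))ˣ) (s : Charge N) (j : ℤ) : MatFun N :=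
  (symbolSum 1 Sum.inl F t s (S s)).coeff j - (symbolSum (-1) Sum.inr F t s (S' s)).coeff (-j)

/-- `H₋ = ∑_{j < 0} h_j Λ^j`. -/
def minusPart (h : ℤ → MatFun N) : MatOp N 1 :=
  ⟨fun j => if j < 0 then h j else 0, 0, fun _ hj => if_neg (not_lt.mpr hj.le)⟩

/-- `H₊ = ∑_{j ≥ 0} h_j Λ^j`, as a series in `Λ⁻¹` that ascends in `Λ`. -/
def plusPart (h : ℤ → MatFun N) : MatOp N (-1) :=
  ⟨fun j => if j ≤ 0 then h (-j) else 0, 0, fun _ hj => if_neg (not_le.mpr hj)⟩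

end Factorization

/-! ### Scalar shift operators -/

/-- Complex functions of the charges `s` and of the discrete variable `n`. -/
abbrev ScalarFun (N : ℕ) := Charge N → ℤ → ℂ

/-- Formal series `∑_{j ≤ d} c_j(s, n) T^j` with `(T f)(s) = f(s + v)`. -/
abbrev ScalarOp {N : ℕ} (v : Charge N) :=
  ShiftSeries (transl v : ScalarFun N ≃ₐ[ℂ] ScalarFun N)

section Scalar

variable {N : ℕ} [NeZero N]

/-- The step of the unbarred shift `T_a`, which is `T_{(1,a₀)}` for `a = 1` and `T_{(a,1)}` for
`a ≠ 1`. -/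
def stepT (a₀ a : Idx N) : Charge N :=
  if a = Sum.inl 0 then step (Sum.inl 0) a₀ else step a (Sum.inl 0)

/-- The step of the barred shift `T̄_a`, which is `T_{(1̄,a₀)}` for `a = 1̄` and `T_{(a,1̄)}` for
`a ≠ 1̄`. -/
def stepTbar (a₀ a : Idx N) : Charge N :=
  if a = Sum.inr 0 then step (Sum.inr 0) a₀ else step a (Sum.inr 0)

/-- The entry `(1,k)` of the coefficient of `Λ^j` in `S(s)` for `a = k`, and of the coefficient of
`Λ^{-j}` in `S̄(s)` for `a = k̄`, at `n`. -/
def rowCoeff (S : Charge N → (MatOp N 1)ˣ) (S' : Charge N → (MatOp N (-1))ˣ) :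
    Idx N → Charge N → ℤ → ℤ → ℂ
  | Sum.inl k, s, j, n => (S s : MatOp N 1).coeff j n 0 k
  | Sum.inr k, s, j, n => (S' s : MatOp N (-1)).coeff j n 0 k

/-- The scalar dressing operator
`𝒦_1 = 1 + φ_{1,11} T^{-1} + ⋯`, `𝒦_k = φ_{1,1k} + φ_{2,1k} T^{-1} + ⋯` (`k ≠ 1`),
`𝒦_{k̄} = φ̄_{0,1k} + φ̄_{1,1k} T^{-1} + ⋯`, in the shift `T` with step `v`. -/
def scalarDressing (v : Charge N) (S : Charge N → (MatOp N 1)ˣ)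
    (S' : Charge N → (MatOp N (-1))ˣ) (a : Idx N) : ScalarOp v :=
  ⟨fun j => if j ≤ 0 then fun s n => rowCoeff S S' a s (j - nu a) n else 0, 0,
    fun _ hj => if_neg (not_le.mpr hj)⟩

variable {v : Charge N} (t : Idx N → ℕ →₀ ℂ) (a : Idx N) (K : (ScalarOp v)ˣ)

/-- `𝒲_a X 𝒲_a⁻¹`, where `𝒲_a = 𝒦_a exp (∑_{j ≥ 1} t_{ja} T^j)`. -/
def scalarDress (X : ScalarOp v) : ScalarOp v :=
  (K : ScalarOp v) *
    expConj (∑ j ∈ Finset.Icc 1 (timeDeg t a), t a j • monomial 1 (j : ℤ)) X *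
    ((K⁻¹ : (ScalarOp v)ˣ) : ScalarOp v)

/-- `ℒ_a^j = 𝒲_a T^j 𝒲_a⁻¹`. -/
def scalarLaxPow (j : ℤ) : ScalarOp v := scalarDress t a K (monomial 1 j)

/-- `ℳ_a = n - ν_a + sg(a) 𝒲_a s_a 𝒲_a⁻¹`. -/
def scalarOrlov : ScalarOp v :=
  (monomial (fun _ n => (n : ℂ) - (nu a : ℂ)) 0 : ScalarOp v) +
    (sg a : ℂ) • scalarDress t a K (monomial (fun s _ => ((s : Idx N → ℤ) a : ℂ)) 0)

/-- `F_a(ℳ_a, ℒ_a) = ∑_{i ≥ 0, j ∈ ℤ} F_{aij} ℳ_a^i ℒ_a^j`. -/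
def scalarSymbol (F : Idx N → ℕ → ℤ → ℂ) : ScalarOp v :=
  evalSymbol (F a) (scalarOrlov t a K) (scalarLaxPow t a K) 1

/-- The projection `X ↦ X₊` for the unbarred shifts: `∑_{j ≥ 0} c_j T^j` for `a = 1` and
`∑_{j > 0} c_j T^j` for `a ≠ 1`. -/
def plusT (X : ScalarOp v) : ScalarOp v :=
  if a = Sum.inl 0 then part (Set.Ici 0) X else part (Set.Ioi 0) X

open Classical in
/-- The projection `X ↦ X₊` for the barred shifts: `∑_{j ≥ 0} c_j T^j` for `a = 1`,
`∑_{j > 0} c_j T^j` for `a = 1̄` if `a₀ = 1`, and `∑_{j > 0} c_j (T^j - 1)` otherwise. -/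
def plusTbar (a₀ : Idx N) (X : ScalarOp v) : ScalarOp v :=
  if a = Sum.inl 0 then part (Set.Ici 0) X
  else if a = Sum.inr 0 ∧ a₀ = Sum.inl 0 then part (Set.Ioi 0) X
  else part (Set.Ioi 0) X - monomial (∑ᶠ j : Set.Ioi (0 : ℤ), X.coeff j) 0

/-- The vector wave function `Ψ_a`, which is `ψ_{1k}` for `a = k` and `ψ̄_{1k}` for `a = k̄`, with
`ψ = W χ`, `ψ̄ = W̄ χ`, `χ(n) = z^n`. It is the product of a formal Laurent series in `z` and the
symbol `exp (∑_{j ≥ 1} t_{ja} z^{sg(a) j})`, which does not depend on `s`, `n` and the extra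
parameter; `wave S S' a s n m` is the coefficient of `z^m` in the Laurent series at `(s, n)`.
An operator `∑_j X_j Λ^j` sends `χ` to `∑_j X_j(n) z^{n+j}`. -/
def wave (S : Charge N → (MatOp N 1)ˣ) (S' : Charge N → (MatOp N (-1))ˣ) :
    Idx N → Charge N → ℤ → ℤ → ℂ
  | Sum.inl k, s, n, m => ((S s : MatOp N 1) * chargeOp 1 Sum.inl s).coeff (m - n) n 0 k
  | Sum.inr k, s, n, m =>
      ((S' s : MatOp N (-1)) * chargeOp (-1) Sum.inr s).coeff (-(m - n)) n 0 k

/-- The action `X(Ψ)(s) = ∑_j c_j(s, n) Ψ(s + j v)` of a scalar operator `X = ∑_j c_j T^j`,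
coefficient by coefficient in `z`. -/
def act (X : ScalarOp v) (Ψ : Charge N → ℤ → ℤ → ℂ) (s : Charge N) (n m : ℤ) : ℂ :=
  ∑ᶠ j : ℤ, X.coeff j s n * Ψ (s + j • v) n m

end Scalar

end

end Toda

open Toda

/-! Write A_k = F_k(M, L) C_kk and B_k = F_{k̄}(M̄, L̄⁻¹) C̄_kk. The proof matches each scalar
operator with the first row of a matrix operator, first without and then with the projections.

Without projections this is a computation. Undoing the conjugation turns A_k into a scalar series in
n and Λ times E_kk (`evalSymbol_dress`), so A_k W has only the column k. On the scalar side, up to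
the exponential symbol, Ψ_a is 𝒦_a applied to z^{n - ν_a + sg(a) s_a}. A shift with v_a = 1
multiplies this power by z^{sg(a)}, so substituting n - ν_a + sg(a) s_a for the variable carries the
same series to 𝒦_a⁻¹ F_a(ℳ_a, ℒ_a) 𝒦_a (`scalarSymbol_eq`). Hence F_a(ℳ_a, ℒ_a) Ψ_a is an entry of
A_k W or B_k W̄ (`coeff_symbol_mul_same`).

The projected operators must be applied to every Ψ_c, not only to Ψ_a. Here the factorization
problem enters through a rigidity principle (`act_eq_of_agree`). A finite operator ∑ c_j T^j acts on
the first rows by ∑ c_j W(s + jv), and W(s + jv) W(s)⁻¹ = W̄(s + jv) W̄(s)⁻¹. The difference between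
this action and a candidate matrix operator, divided by W(s) or by W̄(s), is therefore one and the
same series. If it has only negative powers of Λ by the descending description and only nonnegative
ones by the ascending description, it is zero. Thus only the large exponents of the wave functions
need to be compared, where almost everything vanishes (`act_plusStep_of_ne`, `act_plusStep_same`).
The result is that F_k(ℳ_k, ℒ_k)₊ acts as (A_k)₊ and F_{k̄}(ℳ_{k̄}, ℒ_{k̄})₊ as (B_k)₋.

The proposition is then the pair of identities -H₋ = -∑A_k + ∑(A_k)₊ + ∑(B_k)₋ and H₊ = -∑B_k +
∑(A_k)₊ + ∑(B_k)₋. Nothing depends on the shifts beyond their form T_{(a, p(a))} with p(a) ≠ a, so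
the unbarred and the barred formula are two instances of `hasDerivAt_wave`. -/

namespace Toda

noncomputable section

/-! ### Degree bounds and monomials -/

namespace ShiftSeries

variable {A : Type*} [Ring A] [Algebra ℂ A] {σ : A ≃ₐ[ℂ] A}
variable {B : Type*} [Ring B] [Algebra ℂ B] {τ : B ≃ₐ[ℂ] B}

/-- The series contains no power of the shift above `d`. -/
def DegreeLE (x : ShiftSeries σ) (d : ℤ) : Prop := ∀ j, d < j → x.coeff j = 0

theorem exists_degreeLE (x : ShiftSeries σ) : ∃ d, DegreeLE x d := x.bdd

theorem DegreeLE.mono {x : ShiftSeries σ} {d e : ℤ} (h : DegreeLE x d) (hde : d ≤ e) :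
    DegreeLE x e := fun j hj => h j (hde.trans_lt hj)

theorem support_mul_subset {x y : ShiftSeries σ} {d e : ℤ} (hx : DegreeLE x d)
    (hy : DegreeLE y e) (m : ℤ) :
    (Function.support fun i : ℤ => x.coeff i * (σ ^ i) (y.coeff (m - i))) ⊆
      (Finset.Icc (m - e) d : Finset ℤ) := by
  intro i hi
  rw [Finset.coe_Icc, Set.mem_Icc]
  by_contra h
  apply hi
  by_cases hi' : d < i
  · simp [hx i hi']
  · simp [hy (m - i) (by omega)]

theorem finite_support_mul (x y : ShiftSeries σ) (m : ℤ) :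
    (Function.support fun i : ℤ => x.coeff i * (σ ^ i) (y.coeff (m - i))).Finite := by
  obtain ⟨d, hd⟩ := x.exists_degreeLE
  obtain ⟨e, he⟩ := y.exists_degreeLE
  exact (Finset.finite_toSet _).subset (support_mul_subset hd he m)

theorem DegreeLE.mul {x y : ShiftSeries σ} {d e : ℤ} (hx : DegreeLE x d) (hy : DegreeLE y e) :
    DegreeLE (x * y) (d + e) := by
  intro m hm
  rw [coeff_mul]
  refine finsum_eq_zero_of_forall_eq_zero fun i => ?_
  by_cases hi : d < i
  · simp [hx i hi]
  · simp [hy (m - i) (by omega)]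

theorem DegreeLE.add {x y : ShiftSeries σ} {d : ℤ} (hx : DegreeLE x d) (hy : DegreeLE y d) :
    DegreeLE (x + y) d := fun j hj => by rw [coeff_add, hx j hj, hy j hj, add_zero]

theorem DegreeLE.smul {x : ShiftSeries σ} {d : ℤ} (c : ℂ) (hx : DegreeLE x d) :
    DegreeLE (c • x) d := fun j hj => by rw [coeff_smul, hx j hj, smul_zero]

theorem coeff_sub (x y : ShiftSeries σ) (j : ℤ) : (x - y).coeff j = x.coeff j - y.coeff j := by
  rw [sub_eq_add_neg, coeff_add, coeff_neg, sub_eq_add_neg]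

theorem coeff_part_of_mem {J : Set ℤ} {j : ℤ} (hj : j ∈ J) (X : ShiftSeries σ) :
    (part J X).coeff j = X.coeff j := if_pos hj

theorem coeff_part_of_notMem {J : Set ℤ} {j : ℤ} (hj : j ∉ J) (X : ShiftSeries σ) :
    (part J X).coeff j = 0 := if_neg hj

/-- `coeff j` as a linear map. -/
def coeffLinear (j : ℤ) : ShiftSeries σ →ₗ[ℂ] A where
  toFun x := x.coeff j
  map_add' _ _ := rfl
  map_smul' _ _ := rfl

theorem coeff_sum {ι : Type*} (s : Finset ι) (x : ι → ShiftSeries σ) (j : ℤ) :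
    (∑ i ∈ s, x i).coeff j = ∑ i ∈ s, (x i).coeff j :=
  map_sum (coeffLinear j) x s

theorem DegreeLE.sum {ι : Type*} {s : Finset ι} {x : ι → ShiftSeries σ} {d : ℤ}
    (h : ∀ i ∈ s, DegreeLE (x i) d) : DegreeLE (∑ i ∈ s, x i) d := fun j hj => by
  rw [coeff_sum]
  exact Finset.sum_eq_zero fun i hi => h i hi j hj

theorem degreeLE_monomial (a : A) (j : ℤ) : DegreeLE (monomial a j : ShiftSeries σ) j :=
  fun _ hi => if_neg hi.ne'

theorem one_eq_monomial : (1 : ShiftSeries σ) = monomial 1 0 := rfl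

theorem DegreeLE.pow {x : ShiftSeries σ} {d : ℤ} (hx : DegreeLE x d) (i : ℕ) :
    DegreeLE (x ^ i) (d * i) := by
  induction i with
  | zero =>
    simp only [pow_zero, Nat.cast_zero, mul_zero]
    exact degreeLE_monomial 1 0
  | succ i ih =>
    rw [pow_succ]
    exact (ih.mul hx).mono (by push_cast; linarith)

theorem coeff_monomial_mul (a : A) (i : ℤ) (y : ShiftSeries σ) (m : ℤ) :
    (monomial a i * y).coeff m = a * (σ ^ i) (y.coeff (m - i)) := by
  rw [coeff_mul, finsum_eq_single _ i]
  · rw [coeff_monomial, if_pos rfl]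
  · intro j hj
    rw [coeff_monomial, if_neg hj, zero_mul]

theorem coeff_mul_monomial (x : ShiftSeries σ) (b : A) (j m : ℤ) :
    (x * monomial b j).coeff m = x.coeff (m - j) * (σ ^ (m - j)) b := by
  rw [coeff_mul, finsum_eq_single _ (m - j)]
  · rw [coeff_monomial, if_pos (by omega)]
  · intro i hi
    rw [coeff_monomial, if_neg (by omega), map_zero, mul_zero]

theorem monomial_mul_monomial (a b : A) (i j : ℤ) :
    (monomial a i * monomial b j : ShiftSeries σ) = monomial (a * (σ ^ i) b) (i + j) := by
  ext1
  funext m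
  rw [coeff_monomial_mul, coeff_monomial, coeff_monomial]
  by_cases h : m = i + j
  · rw [if_pos h, if_pos (by omega)]
  · rw [if_neg h, if_neg (by omega), map_zero, mul_zero]

theorem monomial_add (a b : A) (j : ℤ) :
    (monomial (a + b) j : ShiftSeries σ) = monomial a j + monomial b j := by
  ext1
  funext m
  rw [coeff_add, coeff_monomial, coeff_monomial, coeff_monomial]
  split_ifs <;> simp

theorem monomial_smul (c : ℂ) (a : A) (j : ℤ) :
    (monomial (c • a) j : ShiftSeries σ) = c • monomial a j := by
  ext1
  funext m
  rw [coeff_smul, coeff_monomial, coeff_monomial]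
  split_ifs <;> simp

theorem monomial_one_mul_monomial_one (i j : ℤ) :
    (monomial 1 i * monomial 1 j : ShiftSeries σ) = monomial 1 (i + j) := by
  rw [monomial_mul_monomial, map_one, mul_one]

/-- A coefficient that is central and fixed by the shift is a central series. -/
theorem commute_monomial_zero {a : A} (ha : ∀ c, Commute a c) (hσ : ∀ i : ℤ, (σ ^ i) a = a)
    (x : ShiftSeries σ) : Commute (monomial a 0) x := by
  ext1
  funext m
  rw [coeff_monomial_mul, coeff_mul_monomial, hσ, zpow_zero, AlgEquiv.one_apply, sub_zero]
  exact ha _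

/-- The inverse of a series with leading coefficient `1` in degree `0` has no positive powers. -/
theorem degreeLE_inv {u : (ShiftSeries σ)ˣ} (hu : DegreeLE (u : ShiftSeries σ) 0)
    (h1 : (u : ShiftSeries σ).coeff 0 = 1) :
    DegreeLE ((u⁻¹ : (ShiftSeries σ)ˣ) : ShiftSeries σ) 0 := by
  obtain ⟨d, hd⟩ := ((u⁻¹ : (ShiftSeries σ)ˣ) : ShiftSeries σ).exists_degreeLE
  suffices h : ∀ n : ℕ, ∀ j : ℤ, d - n < j → 0 < j →
      ((u⁻¹ : (ShiftSeries σ)ˣ) : ShiftSeries σ).coeff j = 0 from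
    fun j hj => h (d - j + 1).toNat j (by omega) hj
  intro n
  induction n with
  | zero => exact fun j hj _ => hd j (by simpa using hj)
  | succ n ih =>
    intro j hj hj0
    -- Descending induction on the degree: in the coefficient of degree j of u u⁻¹ = 1, the terms
    -- with i < 0 involve u⁻¹ only in degrees above j, and those with i > 0 vanish.
    have h := congrArg (fun x : ShiftSeries σ => x.coeff j) u.mul_inv
    simp only [coeff_mul, coeff_one, if_neg hj0.ne'] at h
    rw [finsum_eq_single _ 0] at h
    · simpa [h1] using h
    · intro i hi
      rcases lt_or_gt_of_ne hi with hi | hi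
      · rw [ih (j - i) (by push_cast at hj; omega) (by omega), map_zero, mul_zero]
      · rw [hu i hi, zero_mul]

/-! ### Change of coefficients -/

/-- Apply a linear map to all coefficients. -/
def map (φ : A →ₗ[ℂ] B) : ShiftSeries σ →ₗ[ℂ] ShiftSeries τ where
  toFun x := ⟨fun j => φ (x.coeff j), by
    obtain ⟨d, hd⟩ := x.bdd
    exact ⟨d, fun j hj => by rw [hd j hj, map_zero]⟩⟩
  map_add' x y := ShiftSeries.ext (funext fun j => map_add φ _ _)
  map_smul' c x := ShiftSeries.ext (funext fun j => map_smul φ _ _)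

theorem coeff_map (φ : A →ₗ[ℂ] B) (x : ShiftSeries σ) (j : ℤ) :
    (map φ x : ShiftSeries τ).coeff j = φ (x.coeff j) := rfl

theorem map_monomial (φ : A →ₗ[ℂ] B) (a : A) (j : ℤ) :
    map φ (monomial a j : ShiftSeries σ) = (monomial (φ a) j : ShiftSeries τ) := by
  ext1
  funext m
  rw [coeff_map, coeff_monomial, coeff_monomial]
  split_ifs <;> simp

/-- Unitality of φ is not required, since `cornerFun k` sends 1 to E_kk. -/
theorem map_mul_of {φ : A →ₗ[ℂ] B} (hφ : ∀ a b, φ (a * b) = φ a * φ b)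
    (hσ : ∀ (i : ℤ) a, φ ((σ ^ i) a) = (τ ^ i) (φ a)) (x y : ShiftSeries σ) :
    (map φ (x * y) : ShiftSeries τ) = map φ x * map φ y := by
  ext1
  funext m
  rw [coeff_map, coeff_mul, coeff_mul]
  refine ((φ : A →+ B).map_finsum (finite_support_mul x y m)).trans (finsum_congr fun i => ?_)
  change φ _ = _
  rw [hφ, hσ, coeff_map, coeff_map]

theorem DegreeLE.map {x : ShiftSeries σ} {d : ℤ} (hx : DegreeLE x d) (φ : A →ₗ[ℂ] B) :
    DegreeLE (map φ x : ShiftSeries τ) d := fun j hj => by rw [coeff_map, hx j hj, map_zero]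

/-! ### Formal infinite sums -/

section FormalSum

variable {ι : Type*}

/-- The sum of the series `f p • y p`, coefficient by coefficient. -/
def formalSum (f : ι → ℂ) (y : ι → ShiftSeries σ) : ShiftSeries σ :=
  ofCoeff fun m => ∑ᶠ p, f p • (y p).coeff m

theorem evalSymbol_eq_formalSum (f : ℕ → ℤ → ℂ) (M : ShiftSeries σ) (L : ℤ → ShiftSeries σ)
    (C : ShiftSeries σ) :
    evalSymbol f M L C =
      formalSum (fun p : ℕ × ℤ => f p.1 p.2) fun p => M ^ p.1 * L p.2 * C := rfl

theorem coeff_ofCoeff {c : ℤ → A} {d : ℤ} (h : ∀ j, d < j → c j = 0) :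
    (ofCoeff c : ShiftSeries σ).coeff = c := by
  unfold ofCoeff
  rw [dif_pos ⟨d, h⟩]

variable {f : ι → ℂ} {y : ι → ShiftSeries σ} {d : ι → ℤ}

theorem coeff_formalSum (hf : ∀ m, {p | f p ≠ 0 ∧ m ≤ d p}.Finite)
    (hy : ∀ p, DegreeLE (y p) (d p)) (m : ℤ) :
    (formalSum f y).coeff m = ∑ᶠ p, f p • (y p).coeff m := by
  -- Only finitely many terms have a degree bound ≥ 0, and all others lie below 0, so the family is
  -- uniformly bounded above.
  obtain ⟨e, he⟩ : ∃ e : ℤ, ∀ p, f p ≠ 0 → d p ≤ e := by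
    obtain ⟨e, he⟩ := ((hf 0).image d).bddAbove
    refine ⟨max e 0, fun p hp => ?_⟩
    by_cases h : 0 ≤ d p
    · exact (he ⟨p, ⟨hp, h⟩, rfl⟩).trans (le_max_left _ _)
    · exact (not_le.mp h).le.trans (le_max_right _ _)
  unfold formalSum
  rw [coeff_ofCoeff (d := e)]
  intro j hj
  refine finsum_eq_zero_of_forall_eq_zero fun p => ?_
  by_cases hp : f p = 0
  · rw [hp, zero_smul]
  · rw [hy p j ((he p hp).trans_lt hj), smul_zero]

/-- One finite partial sum serves all degrees from l on. This reduces infinite sums to finite ones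
in products and under coefficient maps. -/
theorem coeff_formalSum_eq_sum (hf : ∀ m, {p | f p ≠ 0 ∧ m ≤ d p}.Finite)
    (hy : ∀ p, DegreeLE (y p) (d p)) {m l : ℤ} (hlm : l ≤ m) :
    (formalSum f y).coeff m = (∑ p ∈ (hf l).toFinset, f p • y p).coeff m := by
  rw [coeff_formalSum hf hy, coeff_sum]
  refine finsum_eq_sum_of_support_subset _ fun p hp => ?_
  rw [Set.Finite.coe_toFinset]
  refine ⟨fun h => hp ?_, ?_⟩
  · simp [h]
  · by_contra h
    exact hp (by simp [hy p m (by omega)])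

theorem mul_formalSum_mul (hf : ∀ m, {p | f p ≠ 0 ∧ m ≤ d p}.Finite)
    (hy : ∀ p, DegreeLE (y p) (d p)) (P Q : ShiftSeries σ) :
    P * formalSum f y * Q = formalSum f fun p => P * y p * Q := by
  obtain ⟨a, ha⟩ := P.exists_degreeLE
  obtain ⟨b, hb⟩ := Q.exists_degreeLE
  have hf' : ∀ m, {p | f p ≠ 0 ∧ m ≤ a + d p + b}.Finite := fun m =>
    (hf (m - a - b)).subset fun p hp => ⟨hp.1, by linarith [hp.2]⟩
  have hy' : ∀ p, DegreeLE (P * y p * Q) (a + d p + b) := fun p => (ha.mul (hy p)).mul hb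
  ext1
  funext m
  set l := m - a - b with hl
  have hset : (hf' m).toFinset = (hf l).toFinset := by
    ext p
    simp only [Set.Finite.mem_toFinset, Set.mem_ofPred_eq, hl]
    exact and_congr_right fun _ => by constructor <;> intro h <;> linarith
  rw [coeff_formalSum_eq_sum hf' hy' le_rfl, hset]
  have hsum : (∑ p ∈ (hf l).toFinset, f p • (P * y p * Q)) =
      P * (∑ p ∈ (hf l).toFinset, f p • y p) * Q := by
    rw [Finset.mul_sum, Finset.sum_mul]
    exact Finset.sum_congr rfl fun p _ => by rw [mul_smul_comm, smul_mul_assoc]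
  -- The tail of the sum has degree below l = m - a - b, so after multiplication by P and Q it does
  -- not reach degree m.
  have hdeg : DegreeLE (formalSum f y - ∑ p ∈ (hf l).toFinset, f p • y p) (l - 1) := by
    intro j hj
    rw [coeff_sub, coeff_formalSum_eq_sum hf hy (show l ≤ j by omega), sub_self]
  have h0 := ((ha.mul hdeg).mul hb) m (by omega)
  rw [mul_sub, sub_mul, coeff_sub, sub_eq_zero] at h0
  rw [h0, hsum]

theorem map_formalSum (hf : ∀ m, {p | f p ≠ 0 ∧ m ≤ d p}.Finite)
    (hy : ∀ p, DegreeLE (y p) (d p)) (φ : A →ₗ[ℂ] B) :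
    (map φ (formalSum f y) : ShiftSeries τ) = formalSum f fun p => map φ (y p) := by
  ext1
  funext m
  rw [coeff_map, coeff_formalSum_eq_sum hf hy le_rfl,
    coeff_formalSum_eq_sum hf (fun p => (hy p).map φ) le_rfl, ← coeff_map (τ := τ), map_sum]
  simp only [map_smul]

end FormalSum

/-! ### Conjugation by exponentials -/

/-- The adjoint series stops after two terms, because ad θ kills y. All conjugations below are of
this kind. -/
theorem expConj_of_commutator {θ x y : ShiftSeries σ} (h : θ * x - x * θ = y)
    (hy : Commute θ y) : expConj θ x = x + y := by
  have h2 : θ * y - y * θ = 0 := sub_eq_zero.mpr hy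
  have h3 : ∀ m : ℕ, (fun z : ShiftSeries σ => θ * z - z * θ)^[m] 0 = 0 := fun m =>
    Function.iterate_fixed (by simp) m
  unfold expConj
  rw [finsum_eq_sum_of_support_subset (s := Finset.range 2)]
  · simp [Finset.sum_range_succ, h]
  · intro m hm
    by_contra hlt
    apply hm
    obtain ⟨m, rfl⟩ : ∃ k, m = k + 2 := ⟨m - 2, by simp at hlt; omega⟩
    simp only [Function.iterate_add_apply _ m 2, Function.iterate_succ, Function.iterate_zero,
      Function.comp_apply, id, h, h2, h3, smul_zero]

theorem expConj_of_commute {θ x : ShiftSeries σ} (h : Commute θ x) : expConj θ x = x := by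
  rw [expConj_of_commutator (sub_eq_zero.mpr h) (Commute.zero_right _), add_zero]

/-- `∑_{1 ≤ j ≤ D} t_j T^j`. -/
def timeSum (t : ℕ →₀ ℂ) (D : ℕ) : ShiftSeries σ :=
  ∑ j ∈ Finset.Icc 1 D, t j • monomial 1 (j : ℤ)

/-- `∑_{1 ≤ j ≤ D} j t_j T^j`. -/
def timeSumDeriv (t : ℕ →₀ ℂ) (D : ℕ) : ShiftSeries σ :=
  ∑ j ∈ Finset.Icc 1 D, (t j * j) • monomial 1 (j : ℤ)

theorem commute_monomial_one (i j : ℤ) :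
    Commute (monomial 1 i : ShiftSeries σ) (monomial 1 j) := by
  rw [Commute, SemiconjBy, monomial_one_mul_monomial_one, monomial_one_mul_monomial_one, add_comm]

theorem commute_timeSum_monomial (t : ℕ →₀ ℂ) (D : ℕ) (i : ℤ) :
    Commute (timeSum t D : ShiftSeries σ) (monomial 1 i) :=
  Commute.sum_left _ _ _ fun _ _ => (commute_monomial_one _ _).smul_left _

theorem commute_timeSum_timeSumDeriv (t : ℕ →₀ ℂ) (D : ℕ) :
    Commute (timeSum t D : ShiftSeries σ) (timeSumDeriv t D) :=
  Commute.sum_right _ _ _ fun _ _ => (commute_timeSum_monomial _ _ _).smul_right _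

theorem degreeLE_timeSumDeriv (t : ℕ →₀ ℂ) (D : ℕ) :
    DegreeLE (timeSumDeriv t D : ShiftSeries σ) D :=
  DegreeLE.sum fun j hj => ((degreeLE_monomial _ _).smul _).mono
    (by exact_mod_cast (Finset.mem_Icc.mp hj).2)

/-- T^j a - a T^j = (σ^j(a) - a) T^j, and a grows linearly under the shift. It applies both to a =
n, with c = ε, and to a = s_a, with c = 1. -/
theorem timeSum_commutator {a : A} {c : ℂ}
    (ha : ∀ i : ℤ, (σ ^ i) a = a + ((i : ℂ) * c) • (1 : A)) (t : ℕ →₀ ℂ) (D : ℕ) :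
    (timeSum t D : ShiftSeries σ) * monomial a 0 - monomial a 0 * timeSum t D =
      c • timeSumDeriv t D := by
  unfold timeSum timeSumDeriv
  rw [Finset.sum_mul, Finset.mul_sum, ← Finset.sum_sub_distrib, Finset.smul_sum]
  refine Finset.sum_congr rfl fun j _ => ?_
  rw [smul_mul_assoc, mul_smul_comm, monomial_mul_monomial, monomial_mul_monomial, ha, map_one,
    mul_one, one_mul, add_zero, zero_add, monomial_add, monomial_smul, smul_add, add_sub_cancel_left,
    smul_smul, smul_smul]
  congr 1
  push_cast
  ring

end ShiftSeries

open ShiftSeries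

theorem transl_zpow_apply {X R : Type*} [AddCommGroup X] [Ring R] [Algebra ℂ R] (v : X) (i : ℤ)
    (f : X → R) (x : X) : ((transl v : (X → R) ≃ₐ[ℂ] (X → R)) ^ i) f x = f (x + i • v) := by
  induction i using Int.induction_on generalizing f x with
  | zero => simp
  | succ i ih =>
    rw [zpow_add_one, AlgEquiv.mul_apply, ih]
    change f (x + (i : ℤ) • v + v) = _
    rw [add_zsmul, one_zsmul, add_assoc]
  | pred i ih =>
    rw [zpow_sub_one, AlgEquiv.mul_apply, ih]
    change f (x + (-i : ℤ) • v - v) = _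
    rw [sub_zsmul, one_zsmul, add_sub_assoc, ← sub_eq_add_neg]

/-! ### The symbol as a series in one shift -/

/-- Series in a shift of step `ε` whose coefficients are functions of one integer variable. -/
abbrev SymbolOp (ε : ℤ) := ShiftSeries (transl ε : (ℤ → ℂ) ≃ₐ[ℂ] (ℤ → ℂ))

/-- `n + ε ∑_{1 ≤ j ≤ D} j t_j T^j`. -/
def baseOrlov (ε : ℤ) (t : ℕ →₀ ℂ) (D : ℕ) : SymbolOp ε :=
  (monomial (fun n => (n : ℂ)) 0 : SymbolOp ε) + (ε : ℂ) • (timeSumDeriv t D : SymbolOp ε)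

/-- `∑_{i, j} f_{ij} (n + ε ∑_l l t_l T^l)^i T^j`. -/
def baseSymbol (ε : ℤ) (f : ℕ → ℤ → ℂ) (t : ℕ →₀ ℂ) (D : ℕ) : SymbolOp ε :=
  formalSum (fun p : ℕ × ℤ => f p.1 p.2) fun p =>
    baseOrlov ε t D ^ p.1 * (monomial 1 p.2 : SymbolOp ε)

/-- The bound D i + j is the weight in the finiteness condition on the F_a; it makes their symbols
well-defined series. -/
theorem degreeLE_baseOrlov_pow_mul (ε : ℤ) (t : ℕ →₀ ℂ) (D : ℕ) (p : ℕ × ℤ) :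
    DegreeLE (baseOrlov ε t D ^ p.1 * (monomial 1 p.2 : SymbolOp ε)) ((D : ℤ) * p.1 + p.2) := by
  have h1 : DegreeLE (monomial (fun n => (n : ℂ)) 0 : SymbolOp ε) D :=
    (degreeLE_monomial _ 0).mono (Nat.cast_nonneg D)
  have h2 : DegreeLE ((ε : ℂ) • timeSumDeriv t D : SymbolOp ε) D :=
    (degreeLE_timeSumDeriv t D).smul _
  exact ((h1.add h2).pow p.1).mul (degreeLE_monomial _ _)

theorem commutator_baseVar (ε : ℤ) (t : ℕ →₀ ℂ) (D : ℕ) :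
    (timeSum t D : SymbolOp ε) * (monomial (fun n => (n : ℂ)) 0 : SymbolOp ε) -
      (monomial (fun n => (n : ℂ)) 0 : SymbolOp ε) * (timeSum t D : SymbolOp ε) =
      (ε : ℂ) • timeSumDeriv t D := by
  refine timeSum_commutator (fun i => ?_) t D
  funext n
  rw [transl_zpow_apply]
  simp

/-! ### Matrix operators -/

section Matrix

variable {N : ℕ} {ε : ℤ}

/-- `f ↦ f E_kk`. -/
def cornerFun (k : Fin N) : (ℤ → ℂ) →ₗ[ℂ] MatFun N where
  toFun f n := Matrix.single k k (f n)
  map_add' f g := by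
    funext n
    exact Matrix.single_add k k (f n) (g n)
  map_smul' c f := by
    funext n
    exact (Matrix.smul_single c k k (f n)).symm

/-- `x ↦ x E_kk`. -/
def corner (k : Fin N) : SymbolOp ε →ₗ[ℂ] MatOp N ε := map (cornerFun k)

theorem corner_mul_corner (k : Fin N) (x y : SymbolOp ε) :
    corner k (x * y) = corner k x * corner k y := by
  refine map_mul_of (fun a b => ?_) (fun i a => ?_) x y
  · funext n
    change Matrix.single k k (a n * b n) = Matrix.single k k (a n) * Matrix.single k k (b n)
    rw [Matrix.single_mul_single_same]
  · funext n
    rw [transl_zpow_apply]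
    change Matrix.single k k (_) = Matrix.single k k (_)
    rw [transl_zpow_apply]

theorem corner_mul_corner_of_ne {k l : Fin N} (h : k ≠ l) (x y : SymbolOp ε) :
    (corner k x * corner l y : MatOp N ε) = 0 := by
  ext1
  funext m
  rw [coeff_mul, coeff_zero]
  refine finsum_eq_zero_of_forall_eq_zero fun i => ?_
  funext n
  change Matrix.single k k (_) * ((transl ε : MatFun N ≃ₐ[ℂ] MatFun N) ^ i) _ n = _
  rw [transl_zpow_apply]
  change Matrix.single k k (_) * Matrix.single l l (_) = _
  rw [Matrix.single_mul_single_of_ne _ _ _ _ h]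
  rfl

theorem monomial_diagUnit (k : Fin N) (j : ℤ) :
    (monomial (diagUnit k) j : MatOp N ε) = corner k (monomial 1 j) := by
  rw [corner, map_monomial]
  rfl

theorem sum_cornerFun (f : Fin N → ℤ → ℂ) (n : ℤ) :
    (∑ k, cornerFun k (f k)) n = Matrix.diagonal fun k => f k n := by
  rw [Finset.sum_apply]
  change ∑ k, Matrix.single k k (f k n) = _
  rw [Matrix.sum_single_eq_diagonal]

/-- Diagonal matrix operators, as a linear map. -/
def diagLinear (N : ℕ) (ε : ℤ) : (Fin N → SymbolOp ε) →ₗ[ℂ] MatOp N ε where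
  toFun x := ∑ k, corner k (x k)
  map_add' x y := by simp only [Pi.add_apply, map_add, Finset.sum_add_distrib]
  map_smul' c x := by
    simp only [Pi.smul_apply, map_smul, Finset.smul_sum, RingHom.id_apply]

theorem diagLinear_apply (x : Fin N → SymbolOp ε) :
    diagLinear N ε x = ∑ k, corner k (x k) := rfl

theorem coeff_diagLinear (x : Fin N → SymbolOp ε) (j n : ℤ) :
    (diagLinear N ε x).coeff j n = Matrix.diagonal fun k => (x k).coeff j n := by
  rw [diagLinear_apply, coeff_sum]
  exact sum_cornerFun (fun k => (x k).coeff j) n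

theorem diagLinear_one : diagLinear N ε 1 = 1 := by
  ext1
  funext j n
  rw [coeff_diagLinear, coeff_one]
  simp only [Pi.one_apply, coeff_one]
  split_ifs
  · exact Matrix.diagonal_one
  · exact Matrix.diagonal_zero

theorem diagLinear_mul (x y : Fin N → SymbolOp ε) :
    diagLinear N ε (x * y) = diagLinear N ε x * diagLinear N ε y := by
  rw [diagLinear_apply, diagLinear_apply, diagLinear_apply, Finset.sum_mul]
  refine Finset.sum_congr rfl fun k _ => ?_
  rw [Finset.mul_sum, Finset.sum_eq_single k]
  · exact corner_mul_corner k (x k) (y k)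
  · exact fun l _ hl => corner_mul_corner_of_ne (Ne.symm hl) _ _
  · exact fun h => absurd (Finset.mem_univ k) h

/-- Diagonal matrix operators. -/
def diagOp (N : ℕ) (ε : ℤ) : (Fin N → SymbolOp ε) →ₐ[ℂ] MatOp N ε :=
  AlgHom.ofLinearMap (diagLinear N ε) diagLinear_one diagLinear_mul

theorem diagOp_apply (x : Fin N → SymbolOp ε) : diagOp N ε x = ∑ k, corner k (x k) := rfl

theorem coeff_diagOp (x : Fin N → SymbolOp ε) (j n : ℤ) :
    (diagOp N ε x).coeff j n = Matrix.diagonal fun k => (x k).coeff j n :=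
  coeff_diagLinear x j n

theorem diagOp_single (k : Fin N) (x : SymbolOp ε) : diagOp N ε (Pi.single k x) = corner k x := by
  rw [diagOp_apply, Finset.sum_eq_single k]
  · rw [Pi.single_eq_same]
  · intro l _ hl
    rw [Pi.single_eq_of_ne hl, map_zero]
  · exact fun h => absurd (Finset.mem_univ k) h

theorem monomial_eq_diagOp (j : ℤ) (f : ℤ → ℂ) :
    (monomial (fun n => f n • 1) j : MatOp N ε) = diagOp N ε fun _ => monomial f j := by
  ext1
  funext m n
  rw [coeff_diagOp, coeff_monomial]
  simp only [coeff_monomial]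
  split_ifs
  · exact Matrix.smul_one_eq_diagonal _
  · exact Matrix.diagonal_zero.symm

variable (e : Fin N → Idx N) (t : Idx N → ℕ →₀ ℂ) (s : Idx N → ℤ)

theorem chargeOp_eq_diagOp :
    chargeOp ε e s = diagOp N ε fun k => monomial 1 (s (e k)) := by
  rw [diagOp_apply]
  exact Finset.sum_congr rfl fun k _ => monomial_diagUnit k _

theorem timeOp_eq_diagOp :
    timeOp ε e t = diagOp N ε fun k => timeSum (t (e k)) (timeDeg t (e k)) := by
  rw [diagOp_apply]
  refine Finset.sum_congr rfl fun k _ => ?_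
  rw [timeSum, map_sum]
  exact Finset.sum_congr rfl fun j _ => by rw [map_smul, monomial_diagUnit]

theorem chargeOp_mul_chargeOp (s s' : Idx N → ℤ) :
    chargeOp ε e s * chargeOp ε e s' = chargeOp ε e (s + s') := by
  simp only [chargeOp_eq_diagOp, ← map_mul]
  congr 1
  funext k
  exact monomial_one_mul_monomial_one _ _

theorem chargeOp_zero : chargeOp ε e 0 = 1 := by
  rw [chargeOp_eq_diagOp]
  exact map_one (diagOp N ε)

/-- The charge factor as a unit. -/
def chargeUnit : (MatOp N ε)ˣ where
  val := chargeOp ε e s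
  inv := chargeOp ε e (-s)
  val_inv := by rw [chargeOp_mul_chargeOp, add_neg_cancel, chargeOp_zero]
  inv_val := by rw [chargeOp_mul_chargeOp, neg_add_cancel, chargeOp_zero]

/-- Time and charge factors are diagonal with constant coefficients, hence commute. The exponential
therefore only replaces g by g + [θ, g], and what remains is conjugation by a genuine unit. -/
theorem dress_diagOp (P : (MatOp N ε)ˣ) {g h : Fin N → SymbolOp ε}
    (hg : (fun k => timeSum (t (e k)) (timeDeg t (e k))) * g -
      g * (fun k => timeSum (t (e k)) (timeDeg t (e k))) = h)
    (hh : Commute (fun k => timeSum (t (e k)) (timeDeg t (e k))) h) :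
    dress ε e t s P (diagOp N ε g) =
      ((P * chargeUnit e s : (MatOp N ε)ˣ) : MatOp N ε) * diagOp N ε (g + h) *
        (((P * chargeUnit e s)⁻¹ : (MatOp N ε)ˣ) : MatOp N ε) := by
  set θ : Fin N → SymbolOp ε := fun k => timeSum (t (e k)) (timeDeg t (e k)) with hθ
  set c : Fin N → SymbolOp ε := fun k => monomial 1 (s (e k)) with hc
  set c' : Fin N → SymbolOp ε := fun k => monomial 1 ((-s) (e k)) with hc'
  have h1 : Commute θ c := by
    funext k
    exact commute_timeSum_monomial _ _ _
  have h2 : Commute θ c' := by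
    funext k
    exact commute_timeSum_monomial _ _ _
  have hexp : expConj (timeOp ε e t) (chargeOp ε e s * diagOp N ε g * chargeOp ε e (-s)) =
      chargeOp ε e s * diagOp N ε (g + h) * chargeOp ε e (-s) := by
    have key := expConj_of_commutator (θ := timeOp ε e t)
      (x := chargeOp ε e s * diagOp N ε g * chargeOp ε e (-s))
      (y := chargeOp ε e s * diagOp N ε h * chargeOp ε e (-s)) ?_ ?_
    · rw [key, map_add, mul_add, add_mul]
    · simp only [chargeOp_eq_diagOp, timeOp_eq_diagOp, ← map_mul, ← map_sub, ← hθ, ← hc, ← hc',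
        ← hg]
      congr 1
      have e1 : θ * (c * g * c') = c * (θ * g) * c' := by
        rw [← mul_assoc, ← mul_assoc, h1.eq, mul_assoc c]
      have e2 : c * g * c' * θ = c * (g * θ) * c' := by
        rw [mul_assoc, ← h2.eq]; simp only [mul_assoc]
      rw [e1, e2, mul_sub, sub_mul]
    · simp only [chargeOp_eq_diagOp, timeOp_eq_diagOp, ← map_mul]
      exact ((h1.mul_right hh).mul_right h2).map (diagOp N ε)
  rw [dress, hexp, mul_inv_rev, Units.val_mul, Units.val_mul]
  simp only [mul_assoc]
  rfl

theorem dress_diagOp_of_commute (P : (MatOp N ε)ˣ) {g : Fin N → SymbolOp ε}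
    (hg : Commute (fun k => timeSum (t (e k)) (timeDeg t (e k))) g) :
    dress ε e t s P (diagOp N ε g) =
      ((P * chargeUnit e s : (MatOp N ε)ˣ) : MatOp N ε) * diagOp N ε g *
        (((P * chargeUnit e s)⁻¹ : (MatOp N ε)ˣ) : MatOp N ε) := by
  rw [dress_diagOp e t s P (sub_eq_zero.mpr hg) (Commute.zero_right _), add_zero]

theorem orlov_eq (P : (MatOp N ε)ˣ) :
    orlov ε e t s P =
      ((P * chargeUnit e s : (MatOp N ε)ˣ) : MatOp N ε) *
        (diagOp N ε fun k => baseOrlov ε (t (e k)) (timeDeg t (e k))) *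
        (((P * chargeUnit e s)⁻¹ : (MatOp N ε)ˣ) : MatOp N ε) := by
  rw [orlov, monomial_eq_diagOp, dress_diagOp e t s P
    (h := fun k => (ε : ℂ) • timeSumDeriv (t (e k)) (timeDeg t (e k)))]
  · rfl
  · funext k
    exact commutator_baseVar ε _ _
  · funext k
    exact (commute_timeSum_timeSumDeriv _ _).smul_right _

theorem laxPow_eq (P : (MatOp N ε)ˣ) (j : ℤ) :
    laxPow ε e t s P j =
      ((P * chargeUnit e s : (MatOp N ε)ˣ) : MatOp N ε) *
        (diagOp N ε fun _ => monomial 1 j) *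
        (((P * chargeUnit e s)⁻¹ : (MatOp N ε)ˣ) : MatOp N ε) := by
  have h1 : (monomial 1 j : MatOp N ε) = diagOp N ε fun _ => monomial 1 j := by
    rw [← monomial_eq_diagOp]
    congr 1
    funext n
    exact (one_smul ℂ _).symm
  rw [laxPow, h1, dress_diagOp_of_commute]
  funext k
  exact commute_timeSum_monomial _ _ _

theorem diagProj_eq (P : (MatOp N ε)ˣ) (k : Fin N) :
    diagProj ε e t s P k =
      ((P * chargeUnit e s : (MatOp N ε)ˣ) : MatOp N ε) *
        diagOp N ε (Pi.single k 1) *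
        (((P * chargeUnit e s)⁻¹ : (MatOp N ε)ˣ) : MatOp N ε) := by
  rw [diagProj, monomial_diagUnit, ← one_eq_monomial, ← diagOp_single, dress_diagOp_of_commute]
  funext l
  rw [Pi.mul_apply, Pi.mul_apply]
  by_cases h : l = k
  · subst h
    rw [Pi.single_eq_same, mul_one, one_mul]
  · rw [Pi.single_eq_of_ne h, mul_zero, zero_mul]

/-- `F_k(M, L) C_kk = W (∑ F_{kij} (n + ε ∑ l t_l Λ^l)^i Λ^j E_kk) W⁻¹`. -/
theorem evalSymbol_dress (P : (MatOp N ε)ˣ) (k : Fin N) {f : ℕ → ℤ → ℂ}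
    (hf : ∀ m : ℤ, {p : ℕ × ℤ | f p.1 p.2 ≠ 0 ∧
      m ≤ (timeDeg t (e k) : ℤ) * p.1 + p.2}.Finite) :
    evalSymbol f (orlov ε e t s P) (laxPow ε e t s P) (diagProj ε e t s P k) =
      ((P * chargeUnit e s : (MatOp N ε)ˣ) : MatOp N ε) *
        corner k (baseSymbol ε f (t (e k)) (timeDeg t (e k))) *
        (((P * chargeUnit e s)⁻¹ : (MatOp N ε)ˣ) : MatOp N ε) := by
  have hy := degreeLE_baseOrlov_pow_mul ε (t (e k)) (timeDeg t (e k))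
  rw [baseSymbol, corner, map_formalSum hf hy, mul_formalSum_mul hf fun p => (hy p).map _,
    evalSymbol_eq_formalSum]
  congr 1
  funext p
  -- All three factors are conjugates by the same unit, so the inner inverses cancel and the product
  -- is taken among diagonal operators.
  rw [orlov_eq, laxPow_eq, diagProj_eq, Units.conj_pow]
  simp only [mul_assoc, Units.inv_mul_cancel_left]
  congr 1
  simp only [← mul_assoc]
  congr 1
  rw [← map_pow, ← map_mul, ← map_mul]
  change _ = corner k _
  rw [← diagOp_single]
  congr 1
  funext l
  simp only [Pi.mul_apply, Pi.pow_apply]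
  by_cases h : l = k
  · subst h
    rw [Pi.single_eq_same, Pi.single_eq_same, mul_one]
  · rw [Pi.single_eq_of_ne h, Pi.single_eq_of_ne h, mul_zero]

end Matrix

/-! ### Scalar operators -/

theorem charge_zsmul_apply {N : ℕ} (i : ℤ) (r : Charge N) (c : Idx N) :
    ((i • r : Charge N) : Idx N → ℤ) c = i * (r : Idx N → ℤ) c := by
  simp

section Scalar

variable {N : ℕ} [NeZero N] {v : Charge N} (t : Idx N → ℕ →₀ ℂ) (a : Idx N)
  (K : (ScalarOp v)ˣ)

/-- `f ↦ f(n - ν_a + sg(a) s_a)`. -/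
def pullFun : (ℤ → ℂ) →ₗ[ℂ] ScalarFun N where
  toFun f s n := f (n - nu a + sg a * (s : Idx N → ℤ) a)
  map_add' _ _ := rfl
  map_smul' _ _ := rfl

/-- Substitution of `n - ν_a + sg(a) s_a` for the variable. -/
def pull : SymbolOp (sg a) →ₗ[ℂ] ScalarOp v := map (pullFun a)

variable {a}

/-- As v_a = 1, the i-th shift adds sg(a) i to n - ν_a + sg(a) s_a. The substitution thus
intertwines the step sg(a) in one variable with the step v in the charges. -/
theorem pull_mul (hv : (v : Idx N → ℤ) a = 1) (x y : SymbolOp (sg a)) :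
    (pull a (x * y) : ScalarOp v) = pull a x * pull a y := by
  refine map_mul_of (fun _ _ => rfl) (fun i f => ?_) x y
  funext s n
  rw [transl_zpow_apply]
  change ((transl (sg a) : (ℤ → ℂ) ≃ₐ[ℂ] (ℤ → ℂ)) ^ i) f _ = f _
  rw [transl_zpow_apply]
  congr 1
  rw [AddSubgroup.coe_add, Pi.add_apply, charge_zsmul_apply, hv, smul_eq_mul]
  ring

theorem pull_monomial_one (j : ℤ) :
    (pull a (monomial 1 j) : ScalarOp v) = monomial 1 j := by
  rw [pull, map_monomial]
  rfl

theorem pull_timeSumDeriv (u : ℕ →₀ ℂ) (D : ℕ) :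
    (pull a (timeSumDeriv u D) : ScalarOp v) = timeSumDeriv u D := by
  rw [timeSumDeriv, timeSumDeriv, map_sum]
  exact Finset.sum_congr rfl fun j _ => by rw [map_smul, pull_monomial_one]

theorem pull_pow (hv : (v : Idx N → ℤ) a = 1) (x : SymbolOp (sg a)) (i : ℕ) :
    (pull a (x ^ i) : ScalarOp v) = pull a x ^ i := by
  induction i with
  | zero => exact pull_monomial_one 0
  | succ i ih => rw [pow_succ, pow_succ, pull_mul hv, ih]

theorem scalarLaxPow_eq (j : ℤ) :
    scalarLaxPow t a K j =
      (K : ScalarOp v) * pull a (monomial 1 j) * ((K⁻¹ : (ScalarOp v)ˣ) : ScalarOp v) := by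
  rw [scalarLaxPow, scalarDress, pull_monomial_one]
  exact congrArg (fun x : ScalarOp v => (K : ScalarOp v) * x * ((K⁻¹ : (ScalarOp v)ˣ) : ScalarOp v))
    (expConj_of_commute (commute_timeSum_monomial (t a) (timeDeg t a) j))

/-- The shift does not touch n, so n - ν_a is central and may be moved inside the conjugation by
𝒦_a, next to sg(a) s_a. -/
theorem scalarOrlov_eq (hv : (v : Idx N → ℤ) a = 1) :
    scalarOrlov t a K =
      (K : ScalarOp v) * pull a (baseOrlov (sg a) (t a) (timeDeg t a)) *
        ((K⁻¹ : (ScalarOp v)ˣ) : ScalarOp v) := by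
  have hcomm : ∀ x : ScalarOp v,
      Commute (monomial (fun _ n => (n : ℂ) - (nu a : ℂ)) 0 : ScalarOp v) x := by
    refine commute_monomial_zero (fun c => Commute.all _ c) fun i => ?_
    funext s n
    rw [transl_zpow_apply]
  have hexp : expConj (timeSum (t a) (timeDeg t a))
      (monomial (fun s _ => ((s : Idx N → ℤ) a : ℂ)) 0 : ScalarOp v) =
      (monomial (fun s _ => ((s : Idx N → ℤ) a : ℂ)) 0 : ScalarOp v) +
        (timeSumDeriv (t a) (timeDeg t a) : ScalarOp v) := by
    refine expConj_of_commutator ?_ (commute_timeSum_timeSumDeriv _ _)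
    refine (timeSum_commutator (c := 1) (fun i => ?_) _ _).trans (one_smul _ _)
    funext s n
    rw [transl_zpow_apply, AddSubgroup.coe_add, Pi.add_apply, charge_zsmul_apply, hv]
    simp
  have hpull : (pull a (baseOrlov (sg a) (t a) (timeDeg t a)) : ScalarOp v) =
      (monomial (fun _ n => (n : ℂ) - (nu a : ℂ)) 0 : ScalarOp v) + (sg a : ℂ) •
        ((monomial (fun s _ => ((s : Idx N → ℤ) a : ℂ)) 0 : ScalarOp v) +
          (timeSumDeriv (t a) (timeDeg t a) : ScalarOp v)) := by
    rw [baseOrlov, map_add, map_smul, pull_timeSumDeriv, smul_add, ← add_assoc, ← monomial_smul,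
      ← monomial_add, pull, map_monomial]
    congr 2
    funext s n
    change ((n - nu a + sg a * (s : Idx N → ℤ) a : ℤ) : ℂ) = ((n : ℂ) - nu a) + (sg a : ℂ) * _
    push_cast
    rfl
  rw [scalarOrlov, hpull, mul_add, add_mul, ← (hcomm K).eq, mul_assoc (monomial _ 0), Units.mul_inv,
    mul_one, mul_smul_comm, smul_mul_assoc, ← hexp]
  rfl

/-- `F_a(ℳ_a, ℒ_a) = 𝒦_a (∑ F_{aij} (n - ν_a + sg(a) s_a + sg(a) ∑ l t_l T^l)^i T^j) 𝒦_a⁻¹`. -/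
theorem scalarSymbol_eq (hv : (v : Idx N → ℤ) a = 1) {F : Idx N → ℕ → ℤ → ℂ}
    (hF : ∀ m : ℤ, {p : ℕ × ℤ | F a p.1 p.2 ≠ 0 ∧ m ≤ (timeDeg t a : ℤ) * p.1 + p.2}.Finite) :
    scalarSymbol t a K F =
      (K : ScalarOp v) * pull a (baseSymbol (sg a) (F a) (t a) (timeDeg t a)) *
        ((K⁻¹ : (ScalarOp v)ˣ) : ScalarOp v) := by
  have hy := degreeLE_baseOrlov_pow_mul (sg a) (t a) (timeDeg t a)
  rw [scalarSymbol, baseSymbol, pull, map_formalSum hF hy,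
    mul_formalSum_mul hF fun p => (hy p).map _, evalSymbol_eq_formalSum]
  congr 1
  funext p
  change _ = (K : ScalarOp v) * pull a _ * _
  rw [scalarOrlov_eq t K hv, scalarLaxPow_eq, Units.conj_pow, mul_one, pull_mul hv, pull_pow hv]
  simp only [mul_assoc, Units.inv_mul_cancel_left]

end Scalar

/-! ### Matrix entries of products -/

section Entries

variable {N : ℕ} {ε : ℤ}

theorem coeff_mul_entry (x y : MatOp N ε) (r n : ℤ) (i l : Fin N) :
    (x * y).coeff r n i l =
      ∑ᶠ j : ℤ, (x.coeff j n * y.coeff (r - j) (n + j • ε)) i l := by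
  rw [coeff_mul]
  refine (((Matrix.entryAddMonoidHom ℂ i l).comp
    (Pi.evalAddMonoidHom (fun _ : ℤ => Matrix (Fin N) (Fin N) ℂ) n)).map_finsum
    (finite_support_mul x y r)).trans (finsum_congr fun j => ?_)
  change (x.coeff j n * ((transl ε : MatFun N ≃ₐ[ℂ] MatFun N) ^ j) _ n) i l = _
  rw [transl_zpow_apply]

theorem coeff_mul_corner_same (x : MatOp N ε) (k : Fin N) (y : SymbolOp ε) (r n : ℤ)
    (i : Fin N) :
    (x * corner k y).coeff r n i k =
      ∑ᶠ j : ℤ, x.coeff j n i k * y.coeff (r - j) (n + j • ε) := by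
  rw [coeff_mul_entry]
  exact finsum_congr fun j => Matrix.mul_single_apply_same _ _ _ _ _

theorem coeff_mul_corner_of_ne (x : MatOp N ε) {k l : Fin N} (h : l ≠ k) (y : SymbolOp ε)
    (r n : ℤ) (i : Fin N) : (x * corner k y).coeff r n i l = 0 := by
  rw [coeff_mul_entry]
  exact finsum_eq_zero_of_forall_eq_zero fun j => Matrix.mul_single_apply_of_ne _ _ _ _ _ h _

theorem coeff_sum_entry {ι : Type*} (J : Finset ι) (x : ι → MatOp N ε) (r n : ℤ) (i l : Fin N) :
    (∑ j ∈ J, x j).coeff r n i l = ∑ j ∈ J, (x j).coeff r n i l := by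
  rw [coeff_sum, Finset.sum_apply]
  exact Matrix.sum_apply i l J fun j => (x j).coeff r n

theorem coeff_sub_entry (x y : MatOp N ε) (r n : ℤ) (i l : Fin N) :
    (x - y).coeff r n i l = x.coeff r n i l - y.coeff r n i l := by
  rw [coeff_sub]
  rfl

theorem coeff_mul_chargeOp (x : MatOp N ε) (e : Fin N → Idx N) (s : Idx N → ℤ) (r n : ℤ)
    (i k : Fin N) : (x * chargeOp ε e s).coeff r n i k = x.coeff (r - s (e k)) n i k := by
  rw [chargeOp, Finset.mul_sum, coeff_sum_entry, Finset.sum_eq_single k]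
  · rw [coeff_mul_monomial]
    change (x.coeff _ n * ((transl ε : MatFun N ≃ₐ[ℂ] MatFun N) ^ _) (diagUnit k) n) i k = _
    rw [transl_zpow_apply, diagUnit, Matrix.mul_single_apply_same, mul_one]
  · intro l _ hl
    rw [coeff_mul_monomial]
    change (x.coeff _ n * ((transl ε : MatFun N ≃ₐ[ℂ] MatFun N) ^ _) (diagUnit l) n) i k = _
    rw [transl_zpow_apply, diagUnit, Matrix.mul_single_apply_of_ne _ _ _ _ _ (Ne.symm hl)]
  · exact fun h => absurd (Finset.mem_univ k) h

/-- After W⁻¹W cancels, the rightmost factor is supported in the corner (k, k), so every other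
column vanishes. -/
theorem coeff_symbol_mul_of_ne {ε : ℤ} {e : Fin N → Idx N} {k l : Fin N} (hl : l ≠ k)
    (P : (MatOp N ε)ˣ) (s : Idx N → ℤ) (t : Idx N → ℕ →₀ ℂ) {f : ℕ → ℤ → ℂ}
    (hf : ∀ m : ℤ, {p : ℕ × ℤ | f p.1 p.2 ≠ 0 ∧
      m ≤ (timeDeg t (e k) : ℤ) * p.1 + p.2}.Finite) (r n : ℤ) (i : Fin N) :
    (evalSymbol f (orlov ε e t s P) (laxPow ε e t s P) (diagProj ε e t s P k) *
      ((P * chargeUnit e s : (MatOp N ε)ˣ) : MatOp N ε)).coeff r n i l = 0 := by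
  rw [evalSymbol_dress e t s P k hf, Units.inv_mul_cancel_right, coeff_mul_corner_of_ne _ hl]

theorem coeff_mul_scalar_apply {v : Charge N} (X Y : ScalarOp v) (r : ℤ) (s : Charge N) (n : ℤ) :
    (X * Y).coeff r s n = ∑ᶠ j : ℤ, X.coeff j s n * Y.coeff (r - j) (s + j • v) n := by
  rw [coeff_mul]
  refine (((Pi.evalAddMonoidHom (fun _ : ℤ => ℂ) n).comp
    (Pi.evalAddMonoidHom (fun _ : Charge N => ℤ → ℂ) s)).map_finsum
    (finite_support_mul X Y r)).trans (finsum_congr fun j => ?_)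
  change X.coeff j s n * ((transl v : ScalarFun N ≃ₐ[ℂ] ScalarFun N) ^ j) _ s n = _
  rw [transl_zpow_apply]

theorem act_eq_sum {v : Charge N} {Y : ScalarOp v} {J : Finset ℤ} (hY : ∀ j ∉ J, Y.coeff j = 0)
    (Ψ : Charge N → ℤ → ℤ → ℂ) (s : Charge N) (n m : ℤ) :
    act Y Ψ s n m = ∑ j ∈ J, Y.coeff j s n * Ψ (s + j • v) n m := by
  refine finsum_eq_sum_of_support_subset _ fun j hj => ?_
  by_contra h
  exact hj (by simp [hY j h])

end Entries

/-! ### Wave functions as dressed powers of z -/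

section Wave

variable {N : ℕ} [NeZero N] {S : Charge N → (MatOp N 1)ˣ} {S' : Charge N → (MatOp N (-1))ˣ}

theorem wave_eq (c : Idx N) (s : Charge N) (n m : ℤ) :
    wave S S' c s n m = rowCoeff S S' c s (sg c * (m - n) - (s : Idx N → ℤ) c) n := by
  rcases c with k | k
  · rw [wave, coeff_mul_chargeOp, rowCoeff, sg, one_mul]
  · rw [wave, coeff_mul_chargeOp, rowCoeff, sg, neg_one_mul]

/-- This is the origin of ν: for k ≠ 1 the leading coefficient 1 of S has no entry (1, k), so that
row entry starts one degree lower. -/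
theorem rowCoeff_eq_zero (hS : IsFactorization S S') {c : Idx N} {j : ℤ} (hj : -nu c < j)
    (s : Charge N) (n : ℤ) : rowCoeff S S' c s j n = 0 := by
  rcases c with k | k
  · rw [rowCoeff]
    rw [nu] at hj
    by_cases h0 : 0 < j
    · rw [hS.lower_coeff s j h0]
      rfl
    · split_ifs at hj with hk
      · omega
      · obtain rfl : j = 0 := by omega
        rw [hS.lower_leading]
        exact Matrix.one_apply_ne (Ne.symm hk)
  · rw [rowCoeff, hS.upper_coeff s j (by simpa [nu] using hj)]
    rfl

theorem rowCoeff_inl_zero (hS : IsFactorization S S') (s : Charge N) (n : ℤ) :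
    rowCoeff S S' (Sum.inl 0) s 0 n = 1 := by
  rw [rowCoeff, hS.lower_leading]
  exact Matrix.one_apply_eq _

theorem sg_mul_nu (a : Idx N) : sg a * nu a = nu a := by
  rcases a with k | k <;> simp [sg, nu]

variable {v : Charge N}

theorem coeff_scalarDressing (hS : IsFactorization S S') (a : Idx N) (j : ℤ) (s : Charge N)
    (n : ℤ) : (scalarDressing v S S' a).coeff j s n = rowCoeff S S' a s (j - nu a) n := by
  rw [scalarDressing]
  change (if j ≤ 0 then fun s n => rowCoeff S S' a s (j - nu a) n else 0) s n = _
  split_ifs with h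
  · rfl
  · rw [rowCoeff_eq_zero hS (by omega)]
    rfl

/-- The wave function is the dressing operator applied to `z^{n - ν_a + sg(a) s_a}`. -/
theorem act_wave (hS : IsFactorization S S') {a : Idx N} (hv : (v : Idx N → ℤ) a = 1)
    (X : ScalarOp v) (s : Charge N) (n m : ℤ) :
    act X (wave S S' a) s n m =
      (X * scalarDressing v S S' a).coeff
        (sg a * (m - n) + nu a - (s : Idx N → ℤ) a) s n := by
  rw [coeff_mul_scalar_apply]
  refine finsum_congr fun j => ?_
  rw [coeff_scalarDressing hS, wave_eq, AddSubgroup.coe_add, Pi.add_apply, charge_zsmul_apply, hv]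
  congr 2
  ring

/-- Since `act` is a `finsum`, additivity is not automatic; rewriting the action as a coefficient of
a product supplies it. -/
theorem act_sub_wave (hS : IsFactorization S S') {a : Idx N} (hv : (v : Idx N → ℤ) a = 1)
    (X Y : ScalarOp v) (s : Charge N) (n m : ℤ) :
    act (X - Y) (wave S S' a) s n m =
      act X (wave S S' a) s n m - act Y (wave S S' a) s n m := by
  rw [act_wave hS hv, act_wave hS hv, act_wave hS hv, sub_mul, coeff_sub]
  rfl

/-- Both sides are the same convolution with the entries of the dressing. The charge factor
displaces the index by s_a and the definition of 𝒦_a by ν_a, whence the reindexing by s_a - ν_a. -/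
theorem coeff_mul_corner_eq_pull (hS : IsFactorization S S') {a : Idx N}
    {e : Fin N → Idx N} {k : Fin N} (hk : e k = a) (P : MatOp N (sg a)) (s : Charge N)
    (hP : ∀ j n, rowCoeff S S' a s j n = P.coeff j n 0 k)
    (hv : (v : Idx N → ℤ) a = 1) (x : SymbolOp (sg a)) (n m : ℤ) :
    (P * chargeOp (sg a) e s * corner k x).coeff (sg a * (m - n)) n 0 k =
      (scalarDressing v S S' a * pull a x).coeff
        (sg a * (m - n) + nu a - (s : Idx N → ℤ) a) s n := by
  rw [coeff_mul_corner_same, coeff_mul_scalar_apply,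
    ← finsum_comp_equiv (Equiv.addRight ((s : Idx N → ℤ) a - nu a))]
  refine finsum_congr fun j => ?_
  rw [Equiv.coe_addRight, coeff_scalarDressing hS, coeff_mul_chargeOp, hP, hk]
  change _ = _ * x.coeff _ _
  rw [AddSubgroup.coe_add, Pi.add_apply, charge_zsmul_apply, hv, smul_eq_mul]
  have h1 : j + ((s : Idx N → ℤ) a - nu a) - (s : Idx N → ℤ) a = j - nu a := by ring
  have h2 : sg a * (m - n) - (j + ((s : Idx N → ℤ) a - nu a)) =
    sg a * (m - n) + nu a - (s : Idx N → ℤ) a - j := by ring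
  have h3 : n + (j + ((s : Idx N → ℤ) a - nu a)) * sg a =
      n - nu a + sg a * ((s : Idx N → ℤ) a + j * 1) := by
    -- The arguments agree because sg(a) ν_a = ν_a: ν vanishes on barred indices.
    linear_combination -sg_mul_nu a
  rw [h1, h2, h3]

/-- `(F_k(M, L) C_kk W)_{1k}` and `F_a(ℳ_a, ℒ_a) Ψ_a` agree. -/
theorem coeff_symbol_mul_same (hS : IsFactorization S S') {ε : ℤ} {a : Idx N} (hε : sg a = ε)
    {e : Fin N → Idx N} {k : Fin N} (hk : e k = a) (P : (MatOp N ε)ˣ) (s : Charge N)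
    (hP : ∀ j n, rowCoeff S S' a s j n = (P : MatOp N ε).coeff j n 0 k)
    (hv : (v : Idx N → ℤ) a = 1) {K : (ScalarOp v)ˣ}
    (hK : (K : ScalarOp v) = scalarDressing v S S' a) (t : Idx N → ℕ →₀ ℂ)
    {F : Idx N → ℕ → ℤ → ℂ}
    (hF : ∀ m : ℤ, {p : ℕ × ℤ | F a p.1 p.2 ≠ 0 ∧ m ≤ (timeDeg t a : ℤ) * p.1 + p.2}.Finite)
    {r n m : ℤ} (hr : r = ε * (m - n)) :
    (evalSymbol (F (e k)) (orlov ε e t s P) (laxPow ε e t s P) (diagProj ε e t s P k) *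
      ((P * chargeUnit e s : (MatOp N ε)ˣ) : MatOp N ε)).coeff r n 0 k =
      act (scalarSymbol t a K F) (wave S S' a) s n m := by
  subst hε hr
  rw [evalSymbol_dress e t s P k (by rw [hk]; exact hF), Units.inv_mul_cancel_right,
    act_wave hS hv, scalarSymbol_eq t K hv hF, ← hK, Units.inv_mul_cancel_right, hK, hk]
  exact coeff_mul_corner_eq_pull hS hk P s hP hv _ n m

end Wave

/-! ### Operators that are determined by their action -/

section Rigidity

variable {N : ℕ} [NeZero N] {v : Charge N}

/-- `∑_{j ∈ J} c_j E_11 W(s + j v) W(s)⁻¹ - E_11 R`. -/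
def rowDefect {ε : ℤ} (W : Charge N → (MatOp N ε)ˣ) (v : Charge N) (J : Finset ℤ)
    (c : ℤ → ℤ → ℂ) (R : MatOp N ε) (s : Charge N) : MatOp N ε :=
  ∑ j ∈ J, monomial (fun n => Matrix.single 0 0 (c j n)) 0 *
    ((W (s + j • v) * (W s)⁻¹ : (MatOp N ε)ˣ) : MatOp N ε) -
  monomial (fun _ => Matrix.single 0 0 1) 0 * R

theorem coeff_row_mul {ε : ℤ} (c : ℤ → ℂ) (x : MatOp N ε) (r n : ℤ) :
    (monomial (fun n => Matrix.single 0 0 (c n)) 0 * x).coeff r n =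
      Matrix.single 0 0 (c n) * x.coeff r n := by
  rw [coeff_monomial_mul, sub_zero, zpow_zero]
  rfl

theorem single_mul_entry (c : ℂ) (M : Matrix (Fin N) (Fin N) ℂ) (i l : Fin N) :
    (Matrix.single (0 : Fin N) (0 : Fin N) c * M : Matrix (Fin N) (Fin N) ℂ) i l =
      if i = 0 then c * M 0 l else 0 := by
  split_ifs with h
  · subst h
    exact Matrix.single_mul_apply_same _ _ _ _ _
  · exact Matrix.single_mul_apply_of_ne _ _ _ _ _ h _

/-- Multiplying by W(s) cancels W(s)⁻¹ and recovers the difference between the scalar action and R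
W(s). -/
theorem rowDefect_mul {ε : ℤ} (W : Charge N → (MatOp N ε)ˣ) (J : Finset ℤ)
    (c : ℤ → ℤ → ℂ) (R : MatOp N ε) (s : Charge N) (r n : ℤ) (i l : Fin N) :
    (rowDefect W v J c R s * (W s : MatOp N ε)).coeff r n i l =
      if i = 0 then ∑ j ∈ J, c j n * (W (s + j • v) : MatOp N ε).coeff r n 0 l -
        (R * (W s : MatOp N ε)).coeff r n 0 l else 0 := by
  rw [rowDefect, sub_mul, Finset.sum_mul, coeff_sub_entry, coeff_sum_entry]
  simp only [mul_assoc, coeff_row_mul _ _ r n, Units.val_mul, Units.inv_mul, mul_one]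
  rw [single_mul_entry, one_mul]
  simp only [single_mul_entry]
  split_ifs <;> simp

/-- If the product with `P` has no entries from degree `d` on, and `P⁻¹` has no positive powers,
then the operator has no entries from degree `d` on. -/
theorem degreeLE_rowDefect {ε : ℤ} {e : Fin N → Idx N} {P : Charge N → (MatOp N ε)ˣ}
    {J : Finset ℤ} {c : ℤ → ℤ → ℂ} {R : MatOp N ε} {s : Charge N} {d : ℤ}
    (hP : DegreeLE (((P s)⁻¹ : (MatOp N ε)ˣ) : MatOp N ε) 0)
    (h : ∀ r n l, d < r - (s : Idx N → ℤ) (e l) →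
      ∑ j ∈ J, c j n *
        ((P (s + j • v) * chargeUnit e (s + j • v : Charge N) : (MatOp N ε)ˣ) :
          MatOp N ε).coeff r n 0 l =
        (R * ((P s * chargeUnit e s : (MatOp N ε)ˣ) : MatOp N ε)).coeff r n 0 l) :
    DegreeLE (rowDefect (fun s => P s * chargeUnit e s) v J c R s) d := by
  set D := rowDefect (fun s => P s * chargeUnit e s) v J c R s with hD
  have h1 : DegreeLE (D * (P s : MatOp N ε)) d := by
    intro q hq
    funext n
    ext i l
    -- The charge factor only displaces column l by s_{e(l)}, so the hypothesis on exponents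
    -- relative to the charge becomes a uniform degree bound.
    have h2 : (D * (P s : MatOp N ε)).coeff q n i l =
        (D * ((P s * chargeUnit e s : (MatOp N ε)ˣ) : MatOp N ε)).coeff
          (q + (s : Idx N → ℤ) (e l)) n i l := by
      rw [Units.val_mul, ← mul_assoc]
      change _ = (_ * chargeOp ε e s).coeff _ n i l
      rw [coeff_mul_chargeOp, add_sub_cancel_right]
    rw [h2, hD, rowDefect_mul (fun s => P s * chargeUnit e s)]
    split_ifs
    · rw [h _ n l (by omega), sub_self]
      rfl
    · rfl
  have h3 := h1.mul hP
  rwa [Units.mul_inv_cancel_right, add_zero] at h3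

variable {S : Charge N → (MatOp N 1)ˣ} {S' : Charge N → (MatOp N (-1))ˣ}

/-- A finite scalar shift operator acts on the wave functions as the finite matrix operator
`R₁ = R₂` if the two actions agree up to negative powers of `Λ` on the descending wave functions,
and up to nonnegative powers of `Λ` on the ascending ones. -/
theorem act_eq_of_agree (hS : IsFactorization S S') {Y : ScalarOp v} {J : Finset ℤ}
    (hY : ∀ j ∉ J, Y.coeff j = 0) {R₁ : MatOp N 1} {R₂ : MatOp N (-1)}
    (hR : ∀ j, R₁.coeff j = R₂.coeff (-j)) {s : Charge N}
    (h₁ : ∀ n m l, 0 ≤ (m - n) - (s : Idx N → ℤ) (Sum.inl l) →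
      act Y (wave S S' (Sum.inl l)) s n m =
        (R₁ * ((S s * chargeUnit Sum.inl s : (MatOp N 1)ˣ) : MatOp N 1)).coeff (m - n) n 0 l)
    (h₂ : ∀ n m l, 0 < -(m - n) - (s : Idx N → ℤ) (Sum.inr l) →
      act Y (wave S S' (Sum.inr l)) s n m =
        (R₂ * ((S' s * chargeUnit Sum.inr s : (MatOp N (-1))ˣ) : MatOp N (-1))).coeff
          (-(m - n)) n 0 l) :
    (∀ n m l, act Y (wave S S' (Sum.inl l)) s n m =
      (R₁ * ((S s * chargeUnit Sum.inl s : (MatOp N 1)ˣ) : MatOp N 1)).coeff (m - n) n 0 l) ∧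
    (∀ n m l, act Y (wave S S' (Sum.inr l)) s n m =
      (R₂ * ((S' s * chargeUnit Sum.inr s : (MatOp N (-1))ˣ) : MatOp N (-1))).coeff
        (-(m - n)) n 0 l) := by
  set D₁ := rowDefect (fun s => S s * chargeUnit Sum.inl s) v J (fun j n => Y.coeff j s n) R₁ s
    with hD₁
  set D₂ := rowDefect (fun s => S' s * chargeUnit Sum.inr s) v J (fun j n => Y.coeff j s n) R₂ s
    with hD₂
  have e₁ : DegreeLE D₁ (-1) := by
    refine degreeLE_rowDefect (degreeLE_inv (hS.lower_coeff s) (hS.lower_leading s)) ?_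
    intro r n l hr
    have := h₁ n (r + n) l (by omega)
    rw [act_eq_sum hY, add_sub_cancel_right] at this
    rw [← this]
    simp only [wave, add_sub_cancel_right]
    rfl
  have e₂ : DegreeLE D₂ 0 := by
    refine degreeLE_rowDefect (hS.upper_inv_coeff s) ?_
    intro r n l hr
    have hrn : -(-r + n - n) = r := by ring
    have := h₂ n (-r + n) l (by omega)
    rw [act_eq_sum hY, hrn] at this
    rw [← this]
    simp only [wave, hrn]
    rfl
  -- The factorization problem identifies the descending and the ascending defect coefficient by
  -- coefficient.
  have e₃ : ∀ j, D₁.coeff j = D₂.coeff (-j) := by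
    intro j
    rw [hD₁, hD₂, rowDefect, rowDefect, coeff_sub, coeff_sub, coeff_sum, coeff_sum]
    congr 1
    · refine Finset.sum_congr rfl fun i _ => ?_
      funext n
      rw [coeff_row_mul, coeff_row_mul]
      congr 1
      have := congrFun (hS.factor (s + i • v) s j) n
      rw [mul_inv_rev, mul_inv_rev, ← mul_assoc, ← mul_assoc]
      simp only [mul_assoc, Units.val_mul] at this ⊢
      exact this
    · funext n
      rw [coeff_row_mul (fun _ => 1), coeff_row_mul (fun _ => 1), hR]
  -- The first bound excludes powers Λ^j with j ≥ 0, the second, through `e₃`, those with j < 0.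
  have z₁ : D₁ = 0 := by
    ext1
    funext j
    rcases lt_or_ge j 0 with hj | hj
    · rw [e₃, e₂ (-j) (by omega)]
      rfl
    · exact e₁ j (by omega)
  have z₂ : D₂ = 0 := by
    ext1
    funext j
    rw [← neg_neg j, ← e₃, z₁]
    rfl
  constructor
  · intro n m l
    have h := rowDefect_mul (v := v) (fun s => S s * chargeUnit Sum.inl s) J
      (fun j n => Y.coeff j s n) R₁ s (m - n) n 0 l
    rw [← hD₁, z₁, zero_mul, if_pos rfl] at h
    rw [act_eq_sum hY]
    exact sub_eq_zero.mp h.symm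
  · intro n m l
    have h := rowDefect_mul (v := v) (fun s => S' s * chargeUnit Sum.inr s) J
      (fun j n => Y.coeff j s n) R₂ s (-(m - n)) n 0 l
    rw [← hD₂, z₂, zero_mul, if_pos rfl] at h
    rw [act_eq_sum hY]
    exact sub_eq_zero.mp h.symm

end Rigidity

/-! ### The projections X₊ and their coefficients -/

section Plus

variable {N : ℕ}

theorem step_apply_left {a b : Idx N} (hab : a ≠ b) : (step a b : Idx N → ℤ) a = 1 := by
  simp [step, hab]

theorem step_apply_right {a b : Idx N} (hab : a ≠ b) : (step a b : Idx N → ℤ) b = -1 := by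
  simp [step, Ne.symm hab]

theorem step_apply_of_ne {a b c : Idx N} (ha : c ≠ a) (hb : c ≠ b) :
    (step a b : Idx N → ℤ) c = 0 := by
  simp [step, ha, hb]

variable [NeZero N] {v : Charge N}

/-- The common form of the projections `X ↦ X₊` for a shift with step `step a b`. -/
def plusStep (a b : Idx N) (X : ScalarOp v) : ScalarOp v :=
  if a = Sum.inl 0 then part (Set.Ici 0) X
  else if b = Sum.inl 0 then part (Set.Ioi 0) X
  else part (Set.Ioi 0) X - monomial (∑ᶠ j : Set.Ioi (0 : ℤ), X.coeff j) 0

theorem coeff_plusStep_of_neg (a b : Idx N) (X : ScalarOp v) {j : ℤ} (hj : j < 0) :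
    (plusStep a b X).coeff j = 0 := by
  unfold plusStep
  split_ifs
  · exact coeff_part_of_notMem (Set.notMem_Ici.mpr hj) X
  · exact coeff_part_of_notMem (Set.notMem_Ioi.mpr hj.le) X
  · rw [coeff_sub, coeff_part_of_notMem (Set.notMem_Ioi.mpr hj.le) X, coeff_monomial, if_neg hj.ne,
      sub_zero]

theorem coeff_plusStep_of_pos (a b : Idx N) (X : ScalarOp v) {j : ℤ} (hj : 0 < j) :
    (plusStep a b X).coeff j = X.coeff j := by
  unfold plusStep
  split_ifs
  · exact coeff_part_of_mem (Set.mem_Ici.mpr hj.le) X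
  · exact coeff_part_of_mem (Set.mem_Ioi.mpr hj) X
  · rw [coeff_sub, coeff_part_of_mem (Set.mem_Ioi.mpr hj) X, coeff_monomial, if_neg hj.ne', sub_zero]

theorem coeff_plusStep_inl_zero (b : Idx N) (X : ScalarOp v) :
    (plusStep (Sum.inl 0) b X).coeff 0 = X.coeff 0 := by
  unfold plusStep
  rw [if_pos rfl]
  exact coeff_part_of_mem (Set.mem_Ici.mpr le_rfl) X

theorem coeff_plusStep_to_inl_zero {a : Idx N} (ha : a ≠ Sum.inl 0) (X : ScalarOp v) :
    (plusStep a (Sum.inl 0) X).coeff 0 = 0 := by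
  unfold plusStep
  rw [if_neg ha, if_pos rfl]
  exact coeff_part_of_notMem (Set.notMem_Ioi.mpr le_rfl) X

theorem exists_support_plusStep (a b : Idx N) (X : ScalarOp v) :
    ∃ d : ℤ, 0 ≤ d ∧ ∀ j ∉ Finset.Icc 0 d, (plusStep a b X).coeff j = 0 := by
  obtain ⟨d, hd⟩ := X.exists_degreeLE
  refine ⟨max d 0, le_max_right _ _, fun j hj => ?_⟩
  rw [Finset.mem_Icc, not_and_or, not_le, not_le, max_lt_iff] at hj
  rcases hj with hj | hj
  · exact coeff_plusStep_of_neg a b X hj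
  · rw [coeff_plusStep_of_pos a b X hj.2, hd j hj.1]

/-- Off the exceptional indices the coefficients of the projection add up to zero. -/
theorem sum_coeff_plusStep {a b : Idx N} (ha : a ≠ Sum.inl 0) (hb : b ≠ Sum.inl 0)
    (X : ScalarOp v) {d : ℤ} (hd : 0 ≤ d)
    (h : ∀ j ∉ Finset.Icc 0 d, (plusStep a b X).coeff j = 0) :
    ∑ j ∈ Finset.Icc 0 d, (plusStep a b X).coeff j = 0 := by
  have hX : ∀ j, d < j → X.coeff j = 0 := fun j hj => by
    rw [← coeff_plusStep_of_pos a b X (hd.trans_lt hj)]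
    exact h j fun hm => absurd (Finset.mem_Icc.mp hm).2 (not_le.mpr hj)
  have h1 : ∑ᶠ j : Set.Ioi (0 : ℤ), X.coeff j = ∑ j ∈ Finset.Ioc 0 d, X.coeff j := by
    rw [finsum_set_coe_eq_finsum_mem (f := X.coeff)]
    refine finsum_mem_eq_sum_of_inter_support_eq _ ?_
    ext j
    simp only [Set.mem_inter_iff, Set.mem_Ioi, Function.mem_support, Finset.coe_Ioc, Set.mem_Ioc]
    constructor
    · exact fun ⟨hj, hne⟩ => ⟨⟨hj, not_lt.mp fun hlt => hne (hX j hlt)⟩, hne⟩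
    · exact fun ⟨hj, hne⟩ => ⟨hj.1, hne⟩
  have h2 : (plusStep a b X).coeff 0 = -∑ j ∈ Finset.Ioc 0 d, X.coeff j := by
    unfold plusStep
    rw [if_neg ha, if_neg hb, coeff_sub, coeff_part_of_notMem (Set.notMem_Ioi.mpr le_rfl) X,
      coeff_monomial, if_pos rfl, h1, zero_sub]
  rw [← Finset.add_sum_Ioc_eq_sum_Icc hd, h2, neg_add_eq_zero]
  exact Finset.sum_congr rfl fun j hj =>
    (coeff_plusStep_of_pos a b X (Finset.mem_Ioc.mp hj).1).symm

/-! ### Estimates -/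

variable {S : Charge N → (MatOp N 1)ˣ} {S' : Charge N → (MatOp N (-1))ˣ}

/-- The exponent from which on wave functions count as large: `0` on unbarred and `1` on barred
indices. -/
def cutoff : Idx N → ℤ
  | Sum.inl _ => 0
  | Sum.inr _ => 1

/-- At and above the cutoff every wave function except Ψ_1 vanishes; Ψ_1 still has its leading
coefficient 1 exactly at the cutoff. -/
theorem cutoff_pos_of_ne {c : Idx N} (hc : c ≠ Sum.inl 0) : -nu c < cutoff c := by
  rcases c with k | k
  · have : k ≠ 0 := fun h => hc (by rw [h])
    simp [nu, cutoff, this]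
  · simp [nu, cutoff]

theorem nu_inl_zero : nu (Sum.inl 0 : Idx N) = 0 := by simp [nu]

/-- Only powers T^j with j ≥ 0 occur, and they do not raise s_c, so the relative exponent stays
above the cutoff. The one possible contribution is the leading 1 of Ψ_1 at q = 0; the definition of
X₊ for a ≠ 1 is made to cancel it. -/
theorem act_plusStep_of_ne (hS : IsFactorization S S') {a b c : Idx N} (hab : a ≠ b)
    (hv : v = step a b) (hc : c ≠ a) (X : ScalarOp v) {s : Charge N} {n m : ℤ}
    (hq : cutoff c ≤ sg c * (m - n) - (s : Idx N → ℤ) c) :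
    act (plusStep a b X) (wave S S' c) s n m = 0 := by
  obtain ⟨d, hd, hJ⟩ := exists_support_plusStep a b X
  have hw : ∀ j, wave S S' c (s + j • v) n m = rowCoeff S S' c (s + j • v)
      (sg c * (m - n) - (s : Idx N → ℤ) c - j * (v : Idx N → ℤ) c) n := by
    intro j
    rw [wave_eq, AddSubgroup.coe_add, Pi.add_apply, charge_zsmul_apply, sub_sub]
  rw [act_eq_sum hJ]
  simp only [hw]
  set q := sg c * (m - n) - (s : Idx N → ℤ) c with hqdef
  have hvc : (v : Idx N → ℤ) c ≤ 0 := by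
    rw [hv]
    by_cases hb : c = b
    · rw [hb, step_apply_right hab]
      decide
    · rw [step_apply_of_ne hc hb]
  have hmono : ∀ j ∈ Finset.Icc 0 d, q ≤ q - j * (v : Idx N → ℤ) c := fun j hj => by
    nlinarith [(Finset.mem_Icc.mp hj).1]
  by_cases hbig : -nu c < q
  · refine Finset.sum_eq_zero fun j hj => ?_
    rw [rowCoeff_eq_zero hS (hbig.trans_le (hmono j hj)), mul_zero]
  · have hc1 : c = Sum.inl 0 := by
      by_contra h
      exact hbig ((cutoff_pos_of_ne h).trans_le hq)
    subst hc1
    have hq0 : q = 0 := by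
      rw [nu_inl_zero] at hbig
      have : (0 : ℤ) ≤ q := hq
      omega
    -- If the shift lowers s_1, only j = 0 could contribute, and X₊ has no such term. Otherwise s_1
    -- is unchanged, each T^j gives the value 1, and the coefficients of X₊ sum to zero.
    by_cases hb : b = Sum.inl 0
    · subst hb
      refine Finset.sum_eq_zero fun j hj => ?_
      rcases (Finset.mem_Icc.mp hj).1.eq_or_lt with rfl | hj0
      · rw [coeff_plusStep_to_inl_zero hab]
        exact zero_mul _
      · rw [rowCoeff_eq_zero hS, mul_zero]
        rw [hv, step_apply_right hab, hq0, nu_inl_zero]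
        omega
    · have h0 : (v : Idx N → ℤ) (Sum.inl 0) = 0 := by
        rw [hv, step_apply_of_ne hc (Ne.symm hb)]
      simp only [h0, hq0, mul_zero, sub_zero, rowCoeff_inl_zero hS, mul_one]
      have := congrFun (congrFun (sum_coeff_plusStep (Ne.symm hc) hb X hd hJ) s) n
      rwa [Finset.sum_apply, Finset.sum_apply] at this

/-- The discarded powers T^j with j < 0 lower s_a and push the relative exponent past the last
nonzero coefficient. For j = 0, either the coefficient is retained (a = 1) or Ψ_a already vanishes
there. -/
theorem act_plusStep_same (hS : IsFactorization S S') {a b : Idx N} (hab : a ≠ b)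
    (hv : v = step a b) (X : ScalarOp v) {s : Charge N} {n m : ℤ}
    (hq : cutoff a ≤ sg a * (m - n) - (s : Idx N → ℤ) a) :
    act (plusStep a b X) (wave S S' a) s n m = act X (wave S S' a) s n m := by
  have hva : (v : Idx N → ℤ) a = 1 := by rw [hv, step_apply_left hab]
  symm
  rw [← sub_eq_zero, ← act_sub_wave hS hva]
  refine finsum_eq_zero_of_forall_eq_zero fun j => ?_
  rw [wave_eq, AddSubgroup.coe_add, Pi.add_apply, charge_zsmul_apply, hva, mul_one, coeff_sub]
  rcases lt_trichotomy j 0 with hj | rfl | hj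
  · rw [rowCoeff_eq_zero hS, mul_zero]
    by_cases ha : a = Sum.inl 0
    · subst ha
      rw [nu_inl_zero]
      have : (0 : ℤ) ≤ sg (Sum.inl 0 : Idx N) * (m - n) - (s : Idx N → ℤ) (Sum.inl 0) := hq
      omega
    · have := cutoff_pos_of_ne ha
      omega
  · by_cases ha : a = Sum.inl 0
    · subst ha
      rw [coeff_plusStep_inl_zero, sub_self]
      exact zero_mul _
    · rw [rowCoeff_eq_zero hS, mul_zero]
      have := cutoff_pos_of_ne ha
      omega
  · rw [coeff_plusStep_of_pos a b X hj, sub_self]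
    exact zero_mul _

end Plus

/-! ### The action of the projected symbols -/

section Symbols

variable {N : ℕ}

theorem degreeLE_minusPart (h : ℤ → MatFun N) : DegreeLE (minusPart h) (-1) :=
  fun _ hj => if_neg (by omega)

theorem degreeLE_plusPart (h : ℤ → MatFun N) : DegreeLE (plusPart h) 0 :=
  fun _ hj => if_neg (by omega)

theorem coeff_mul_chargeUnit {ε : ℤ} (x : MatOp N ε) (P : (MatOp N ε)ˣ) (e : Fin N → Idx N)
    (s : Idx N → ℤ) (r n : ℤ) (i l : Fin N) :
    (x * ((P * chargeUnit e s : (MatOp N ε)ˣ) : MatOp N ε)).coeff r n i l =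
      (x * (P : MatOp N ε)).coeff (r - s (e l)) n i l := by
  rw [Units.val_mul, ← mul_assoc]
  exact coeff_mul_chargeOp _ e s r n i l

theorem coeff_mul_chargeUnit_eq_zero {ε : ℤ} {x : MatOp N ε} {P : (MatOp N ε)ˣ} {d : ℤ}
    (hx : DegreeLE x d) (hP : DegreeLE (P : MatOp N ε) 0) (e : Fin N → Idx N) (s : Idx N → ℤ)
    {r : ℤ} {l : Fin N} (hr : d < r - s (e l)) (n : ℤ) (i : Fin N) :
    (x * ((P * chargeUnit e s : (MatOp N ε)ˣ) : MatOp N ε)).coeff r n i l = 0 := by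
  rw [coeff_mul_chargeUnit, (hx.mul hP) _ (by omega)]
  rfl

variable (F : Idx N → ℕ → ℤ → ℂ) (t : Idx N → ℕ →₀ ℂ)

/-- `F_k(M, L) C_kk`, respectively `F_{k̄}(M̄, L̄⁻¹) C̄_kk`. -/
def symbolTerm {ε : ℤ} (e : Fin N → Idx N) (s : Idx N → ℤ) (P : (MatOp N ε)ˣ) (k : Fin N) :
    MatOp N ε :=
  evalSymbol (F (e k)) (orlov ε e t s P) (laxPow ε e t s P) (diagProj ε e t s P k)

variable {S : Charge N → (MatOp N 1)ˣ} {S' : Charge N → (MatOp N (-1))ˣ}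

variable {F}

theorem minusPart_symmetryCoeff (s : Charge N) :
    minusPart (symmetryCoeff F t S S' s) =
      ∑ k, minusPart (symbolTerm F t Sum.inl s (S s) k).coeff -
      ∑ k, minusPart (fun j => (symbolTerm F t Sum.inr s (S' s) k).coeff (-j)) := by
  ext1
  funext j
  rw [coeff_sub, coeff_sum, coeff_sum]
  change (if j < 0 then symmetryCoeff F t S S' s j else 0) =
    ∑ k, (if j < 0 then _ else _) - ∑ k, if j < 0 then _ else _
  split_ifs
  · rw [symmetryCoeff, symbolSum, symbolSum, coeff_sum, coeff_sum]
    rfl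
  · simp

theorem plusPart_symmetryCoeff (s : Charge N) :
    plusPart (symmetryCoeff F t S S' s) =
      ∑ k, plusPart (symbolTerm F t Sum.inl s (S s) k).coeff -
      ∑ k, plusPart (fun j => (symbolTerm F t Sum.inr s (S' s) k).coeff (-j)) := by
  ext1
  funext j
  rw [coeff_sub, coeff_sum, coeff_sum]
  change (if j ≤ 0 then symmetryCoeff F t S S' s (-j) else 0) =
    ∑ k, (if j ≤ 0 then _ else _) - ∑ k, if j ≤ 0 then _ else _
  split_ifs
  · rw [symmetryCoeff, symbolSum, symbolSum, coeff_sum, coeff_sum]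
    rfl
  · simp

variable [NeZero N] {v : Charge N}

/-- `F_k(ℳ_k, ℒ_k)₊` acts on the wave functions as the first row of `(F_k(M, L) C_kk)₊`. -/
theorem act_plusStep_inl (hS : IsFactorization S S') {k : Fin N} {b : Idx N}
    (hab : Sum.inl k ≠ b) (hv : v = step (Sum.inl k) b) {K : (ScalarOp v)ˣ}
    (hK : (K : ScalarOp v) = scalarDressing v S S' (Sum.inl k))
    (hF : ∀ (a : Idx N) (m : ℤ),
      {p : ℕ × ℤ | F a p.1 p.2 ≠ 0 ∧ m ≤ (timeDeg t a : ℤ) * p.1 + p.2}.Finite)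
    (s : Charge N) :
    (∀ n m l, act (plusStep (Sum.inl k) b (scalarSymbol t (Sum.inl k) K F))
        (wave S S' (Sum.inl l)) s n m =
      ((symbolTerm F t Sum.inl s (S s) k -
          minusPart (symbolTerm F t Sum.inl s (S s) k).coeff) *
        ((S s * chargeUnit Sum.inl s : (MatOp N 1)ˣ) : MatOp N 1)).coeff (m - n) n 0 l) ∧
    (∀ n m l, act (plusStep (Sum.inl k) b (scalarSymbol t (Sum.inl k) K F))
        (wave S S' (Sum.inr l)) s n m =
      (plusPart (symbolTerm F t Sum.inl s (S s) k).coeff *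
        ((S' s * chargeUnit Sum.inr s : (MatOp N (-1))ˣ) : MatOp N (-1))).coeff
          (-(m - n)) n 0 l) := by
  have hva : (v : Idx N → ℤ) (Sum.inl k) = 1 := by rw [hv, step_apply_left hab]
  obtain ⟨d, -, hJ⟩ := exists_support_plusStep (Sum.inl k) b (scalarSymbol t (Sum.inl k) K F)
  -- A - A₋ as a descending and A₊ as an ascending series have the same coefficients, so they are
  -- admissible as R₁ and R₂.
  refine act_eq_of_agree hS hJ (fun j => ?_) (fun n m l hq => ?_) (fun n m l hq => ?_)
  · rw [coeff_sub]
    change _ - (if j < 0 then _ else _) = if -j ≤ 0 then _ else _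
    by_cases hj : j < 0
    · rw [if_pos hj, if_neg (by omega), sub_self]
    · rw [if_neg hj, if_pos (by omega), sub_zero, neg_neg]
  · have hq' : cutoff (Sum.inl l) ≤
        sg (Sum.inl l : Idx N) * (m - n) - (s : Idx N → ℤ) (Sum.inl l) := by
      rwa [cutoff, sg, one_mul]
    -- At relative exponents ≥ 0 the part A₋ contributes nothing, so the comparison is with the
    -- unprojected symbol.
    rw [sub_mul, coeff_sub_entry, coeff_mul_chargeUnit_eq_zero (degreeLE_minusPart _)
      (hS.lower_coeff s) _ _ (by omega), sub_zero]
    by_cases hl : l = k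
    · subst hl
      rw [act_plusStep_same hS hab hv _ hq']
      exact (coeff_symbol_mul_same (e := Sum.inl) hS rfl rfl (S s) s (fun _ _ => rfl) hva hK t
        (hF _) (one_mul _).symm).symm
    · rw [act_plusStep_of_ne hS hab hv (fun h => hl (Sum.inl_injective h)) _ hq']
      exact (coeff_symbol_mul_of_ne hl _ _ t (hF _) _ _ _).symm
  · have hq' : cutoff (Sum.inr l) ≤
        sg (Sum.inr l : Idx N) * (m - n) - (s : Idx N → ℤ) (Sum.inr l) := by
      rw [cutoff, sg]
      omega
    rw [act_plusStep_of_ne hS hab hv (by simp) _ hq', coeff_mul_chargeUnit_eq_zero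
      (degreeLE_plusPart _) (hS.upper_coeff s) _ _ hq]

/-- `F_{k̄}(ℳ_{k̄}, ℒ_{k̄})₊` acts on the wave functions as the first row of
`(F_{k̄}(M̄, L̄⁻¹) C̄_kk)₋`. -/
theorem act_plusStep_inr (hS : IsFactorization S S') {k : Fin N} {b : Idx N}
    (hab : Sum.inr k ≠ b) (hv : v = step (Sum.inr k) b) {K : (ScalarOp v)ˣ}
    (hK : (K : ScalarOp v) = scalarDressing v S S' (Sum.inr k))
    (hF : ∀ (a : Idx N) (m : ℤ),
      {p : ℕ × ℤ | F a p.1 p.2 ≠ 0 ∧ m ≤ (timeDeg t a : ℤ) * p.1 + p.2}.Finite)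
    (s : Charge N) :
    (∀ n m l, act (plusStep (Sum.inr k) b (scalarSymbol t (Sum.inr k) K F))
        (wave S S' (Sum.inl l)) s n m =
      (minusPart (fun j => (symbolTerm F t Sum.inr s (S' s) k).coeff (-j)) *
        ((S s * chargeUnit Sum.inl s : (MatOp N 1)ˣ) : MatOp N 1)).coeff (m - n) n 0 l) ∧
    (∀ n m l, act (plusStep (Sum.inr k) b (scalarSymbol t (Sum.inr k) K F))
        (wave S S' (Sum.inr l)) s n m =
      ((symbolTerm F t Sum.inr s (S' s) k -
          plusPart (fun j => (symbolTerm F t Sum.inr s (S' s) k).coeff (-j))) *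
        ((S' s * chargeUnit Sum.inr s : (MatOp N (-1))ˣ) : MatOp N (-1))).coeff
          (-(m - n)) n 0 l) := by
  have hva : (v : Idx N → ℤ) (Sum.inr k) = 1 := by rw [hv, step_apply_left hab]
  obtain ⟨d, -, hJ⟩ := exists_support_plusStep (Sum.inr k) b (scalarSymbol t (Sum.inr k) K F)
  -- The roles are exchanged: B₋ is the descending form, and B - B₊ the ascending one.
  refine act_eq_of_agree hS hJ (fun j => ?_) (fun n m l hq => ?_) (fun n m l hq => ?_)
  · rw [coeff_sub]
    change (if j < 0 then _ else _) = _ - (if -j ≤ 0 then _ else _)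
    by_cases hj : j < 0
    · rw [if_pos hj, if_neg (by omega), sub_zero]
    · rw [if_neg hj, if_pos (by omega), neg_neg, sub_self]
  · have hq' : cutoff (Sum.inl l) ≤
        sg (Sum.inl l : Idx N) * (m - n) - (s : Idx N → ℤ) (Sum.inl l) := by
      rwa [cutoff, sg, one_mul]
    rw [act_plusStep_of_ne hS hab hv (by simp) _ hq', coeff_mul_chargeUnit_eq_zero
      (degreeLE_minusPart _) (hS.lower_coeff s) _ _ (by omega)]
  · have hq' : cutoff (Sum.inr l) ≤
        sg (Sum.inr l : Idx N) * (m - n) - (s : Idx N → ℤ) (Sum.inr l) := by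
      rw [cutoff, sg]
      omega
    rw [sub_mul, coeff_sub_entry, coeff_mul_chargeUnit_eq_zero (degreeLE_plusPart _)
      (hS.upper_coeff s) _ _ hq, sub_zero]
    by_cases hl : l = k
    · subst hl
      rw [act_plusStep_same hS hab hv _ hq']
      exact (coeff_symbol_mul_same (e := Sum.inr) hS rfl rfl (S' s) s (fun _ _ => rfl) hva hK t
        (hF _) (neg_one_mul _).symm).symm
    · rw [act_plusStep_of_ne hS hab hv (fun h => hl (Sum.inr_injective h)) _ hq']
      exact (coeff_symbol_mul_of_ne hl _ _ t (hF _) _ _ _).symm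

/-! ### The symmetry -/

/-- The symmetry on the level of the matrix operators, applied to the wave functions, equals the
symmetry on the level of the scalar operators, for any choice of the shifts `step a (p a)`. -/
theorem symmetry_eq_act (hS : IsFactorization S S') {p : Idx N → Idx N} (hp : ∀ a, a ≠ p a)
    {w : Idx N → Charge N} (hw : ∀ a, w a = step a (p a)) {K : ∀ a, (ScalarOp (w a))ˣ}
    (hK : ∀ a, (K a : ScalarOp (w a)) = scalarDressing (w a) S S' a)
    (hF : ∀ (a : Idx N) (m : ℤ),
      {p : ℕ × ℤ | F a p.1 p.2 ≠ 0 ∧ m ≤ (timeDeg t a : ℤ) * p.1 + p.2}.Finite)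
    (s : Charge N) (n m : ℤ) (l : Fin N) :
    -(minusPart (symmetryCoeff F t S S' s) *
        ((S s * chargeUnit Sum.inl s : (MatOp N 1)ˣ) : MatOp N 1)).coeff (m - n) n 0 l =
      -act (scalarSymbol t (Sum.inl l) (K (Sum.inl l)) F) (wave S S' (Sum.inl l)) s n m +
        ∑ c, act (plusStep c (p c) (scalarSymbol t c (K c) F)) (wave S S' (Sum.inl l)) s n m ∧
    (plusPart (symmetryCoeff F t S S' s) *
        ((S' s * chargeUnit Sum.inr s : (MatOp N (-1))ˣ) : MatOp N (-1))).coeff (-(m - n)) n 0 l =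
      -act (scalarSymbol t (Sum.inr l) (K (Sum.inr l)) F) (wave S S' (Sum.inr l)) s n m +
        ∑ c, act (plusStep c (p c) (scalarSymbol t c (K c) F)) (wave S S' (Sum.inr l)) s n m := by
  have hwa : ∀ a, (w a : Idx N → ℤ) a = 1 := fun a => by rw [hw, step_apply_left (hp a)]
  have hl := fun k => act_plusStep_inl t hS (hp (Sum.inl k)) (hw _) (hK _) hF s
  have hr := fun k => act_plusStep_inr t hS (hp (Sum.inr k)) (hw _) (hK _) hF s
  -- Only the term k = l meets column l, so the sum over k collapses to one unprojected symbol.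
  have h1 : ∑ k, (symbolTerm F t Sum.inl s (S s) k *
      ((S s * chargeUnit Sum.inl s : (MatOp N 1)ˣ) : MatOp N 1)).coeff (m - n) n 0 l =
      act (scalarSymbol t (Sum.inl l) (K (Sum.inl l)) F) (wave S S' (Sum.inl l)) s n m := by
    rw [Finset.sum_eq_single l]
    · exact coeff_symbol_mul_same (e := Sum.inl) hS rfl rfl (S s) s (fun _ _ => rfl) (hwa _)
        (hK _) t (hF _) (one_mul _).symm
    · exact fun k _ hk => coeff_symbol_mul_of_ne (Ne.symm hk) _ _ t (hF _) _ _ _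
    · exact fun h => absurd (Finset.mem_univ l) h
  have h2 : ∑ k, (symbolTerm F t Sum.inr s (S' s) k *
      ((S' s * chargeUnit Sum.inr s : (MatOp N (-1))ˣ) : MatOp N (-1))).coeff (-(m - n)) n 0 l =
      act (scalarSymbol t (Sum.inr l) (K (Sum.inr l)) F) (wave S S' (Sum.inr l)) s n m := by
    rw [Finset.sum_eq_single l]
    · exact coeff_symbol_mul_same (e := Sum.inr) hS rfl rfl (S' s) s (fun _ _ => rfl) (hwa _)
        (hK _) t (hF _) (neg_one_mul _).symm
    · exact fun k _ hk => coeff_symbol_mul_of_ne (Ne.symm hk) _ _ t (hF _) _ _ _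
    · exact fun h => absurd (Finset.mem_univ l) h
  constructor
  -- Splitting the sum over indices into unbarred and barred ones leaves -H₋ = -∑A_k + ∑(A_k -
  -- (A_k)₋) + ∑(B_k)₋.
  · rw [Fintype.sum_sum_type]
    simp only [(hl _).1, (hr _).1, sub_mul, coeff_sub_entry, Finset.sum_sub_distrib,
      minusPart_symmetryCoeff, Finset.sum_mul, coeff_sum_entry, h1]
    ring
  · rw [Fintype.sum_sum_type]
    simp only [(hl _).2, (hr _).2, sub_mul, coeff_sub_entry, Finset.sum_sub_distrib,
      plusPart_symmetryCoeff, Finset.sum_mul, coeff_sum_entry, h2]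
    ring

/-- The infinitesimal symmetry of the wave functions, for any choice of the shifts. -/
theorem hasDerivAt_wave {S : ℂ → Charge N → (MatOp N 1)ˣ} {S' : ℂ → Charge N → (MatOp N (-1))ˣ}
    {β : ℂ} (hS : IsFactorization (S β) (S' β))
    (hW : ∀ (s : Charge N) (j n : ℤ) (k : Fin N),
      HasDerivAt (fun β => (S β s : MatOp N 1).coeff j n 0 k)
        (-(minusPart (symmetryCoeff F t (S β) (S' β) s) *
          (S β s : MatOp N 1)).coeff j n 0 k) β)
    (hW' : ∀ (s : Charge N) (j n : ℤ) (k : Fin N),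
      HasDerivAt (fun β => (S' β s : MatOp N (-1)).coeff j n 0 k)
        ((plusPart (symmetryCoeff F t (S β) (S' β) s) *
          (S' β s : MatOp N (-1))).coeff j n 0 k) β)
    {p : Idx N → Idx N} (hp : ∀ a, a ≠ p a)
    {w : Idx N → Charge N} (hw : ∀ a, w a = step a (p a)) {K : ∀ a, (ScalarOp (w a))ˣ}
    (hK : ∀ a, (K a : ScalarOp (w a)) = scalarDressing (w a) (S β) (S' β) a)
    (hF : ∀ (a : Idx N) (m : ℤ),
      {p : ℕ × ℤ | F a p.1 p.2 ≠ 0 ∧ m ≤ (timeDeg t a : ℤ) * p.1 + p.2}.Finite)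
    (a : Idx N) (s : Charge N) (n m : ℤ) :
    HasDerivAt (fun β => wave (S β) (S' β) a s n m)
      (-act (scalarSymbol t a (K a) F) (wave (S β) (S' β) a) s n m +
        ∑ c, act (plusStep c (p c) (scalarSymbol t c (K c) F)) (wave (S β) (S' β) a) s n m) β := by
  rcases a with l | l
  -- The charge factor does not depend on β and only displaces the degree, so each wave coefficient
  -- is a single coefficient of S.
  · have h := hW s (m - n - (s : Idx N → ℤ) (Sum.inl l)) n l
    rw [← coeff_mul_chargeUnit, (symmetry_eq_act t hS hp hw hK hF s n m l).1] at h
    simpa only [wave, coeff_mul_chargeOp] using h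
  · have h := hW' s (-(m - n) - (s : Idx N → ℤ) (Sum.inr l)) n l
    rw [← coeff_mul_chargeUnit _ _ Sum.inr,
      (symmetry_eq_act t hS hp hw hK hF s n m l).2] at h
    simpa only [wave, coeff_mul_chargeOp] using h

/-- For a ≠ 1 the partner index is 1, so the branch with the subtracted constant never occurs. -/
theorem plusT_eq_plusStep (a₀ a : Idx N) (X : ScalarOp v) :
    plusT a X = plusStep a (if a = Sum.inl 0 then a₀ else Sum.inl 0) X := by
  unfold plusT plusStep
  by_cases h : a = Sum.inl 0 <;> simp [h]

/-- For a ≠ 1̄ the partner index is 1̄, which differs from 1. The middle branch thus occurs only for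
a = 1̄ with partner 1. -/
theorem plusTbar_eq_plusStep (a₁ a : Idx N) (X : ScalarOp v) :
    plusTbar a a₁ X = plusStep a (if a = Sum.inr 0 then a₁ else Sum.inr 0) X := by
  unfold plusTbar plusStep
  by_cases h0 : a = Sum.inl 0
  · rw [if_pos h0, if_pos h0]
  · rw [if_neg h0, if_neg h0]
    by_cases h1 : a = Sum.inr 0 <;> by_cases h2 : a₁ = Sum.inl 0 <;> simp [h1, h2]

end Symbols

end

end Toda

open Toda
theorem mainTheorem3 (N : ℕ) [NeZero N]
    (a₀ a₁ : Idx N) (ha₀ : a₀ ≠ Sum.inl 0) (ha₁ : a₁ ≠ Sum.inr 0)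
    (t : Idx N → ℕ →₀ ℂ)
    (F : Idx N → ℕ → ℤ → ℂ)
    (hF : ∀ (a : Idx N) (m : ℤ),
      {p : ℕ × ℤ | F a p.1 p.2 ≠ 0 ∧ m ≤ (timeDeg t a : ℤ) * p.1 + p.2}.Finite)
    (U : Set ℂ) (hU : IsOpen U)
    (S : ℂ → Charge N → (MatOp N 1)ˣ) (S' : ℂ → Charge N → (MatOp N (-1))ˣ)
    (hS : ∀ β ∈ U, IsFactorization (S β) (S' β))
    (b : ℂ) (hb : b ∈ U)
    (hW : ∀ (s : Charge N) (j n : ℤ) (k : Fin N),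
      HasDerivAt (fun β => (S β s : MatOp N 1).coeff j n 0 k)
        (-(minusPart (symmetryCoeff F t (S b) (S' b) s) * (S b s : MatOp N 1)).coeff j n 0 k) b)
    (hW' : ∀ (s : Charge N) (j n : ℤ) (k : Fin N),
      HasDerivAt (fun β => (S' β s : MatOp N (-1)).coeff j n 0 k)
        ((plusPart (symmetryCoeff F t (S b) (S' b) s) * (S' b s : MatOp N (-1))).coeff j n 0 k) b)
    (K : ∀ a, (ScalarOp (stepT a₀ a))ˣ)
    (hK : ∀ a, (K a : ScalarOp (stepT a₀ a)) = scalarDressing (stepT a₀ a) (S b) (S' b) a)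
    (K' : ∀ a, (ScalarOp (stepTbar a₁ a))ˣ)
    (hK' : ∀ a, (K' a : ScalarOp (stepTbar a₁ a)) =
      scalarDressing (stepTbar a₁ a) (S b) (S' b) a) :
    ∀ (a : Idx N) (s : Charge N) (n m : ℤ),
      HasDerivAt (fun β => wave (S β) (S' β) a s n m)
        (-act (scalarSymbol t a (K a) F) (wave (S b) (S' b) a) s n m +
          ∑ c, act (plusT c (scalarSymbol t c (K c) F)) (wave (S b) (S' b) a) s n m) b ∧
      HasDerivAt (fun β => wave (S β) (S' β) a s n m)
        (-act (scalarSymbol t a (K' a) F) (wave (S b) (S' b) a) s n m +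
          ∑ c, act (plusTbar c a₁ (scalarSymbol t c (K' c) F)) (wave (S b) (S' b) a) s n m) b := by
  intro a s n m
  constructor
  · simp only [plusT_eq_plusStep a₀]
    -- The partner index is p(1) = a₀ and p(c) = 1 for c ≠ 1; the two goals are p(c) ≠ c and the
    -- form of the step.
    refine hasDerivAt_wave t (hS b hb) hW hW' (fun c => ?_) (fun c => ?_) hK hF a s n m
    · split_ifs with h
      · rw [h]
        exact ha₀.symm
      · exact h
    · unfold stepT
      split_ifs with h
      · rw [h]
      · rfl
  · simp only [plusTbar_eq_plusStep a₁]
    refine hasDerivAt_wave t (hS b hb) hW hW' (fun c => ?_) (fun c => ?_) hK' hF a s n m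
    · split_ifs with h
      · rw [h]
        exact ha₁.symm
      · exact h
    · unfold stepTbar
      split_ifs with h
      · rw [h]
      · rfl
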